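/- **Proposition (2-runs).** Let $n\ge 9$ be an integer and $0<p<2/3$. Let $\xi_1,\dots,\xi_n$ be independent random variables with $\mathbb{P}(\xi_i=1)=p=1-\mathbb{P}(\xi_i=0)$, put $\xi_{n+1}:=\xi_1$, and let $W=\sum_{i=1}^n \xi_i\xi_{i+1}$ be the number of 2-runs, with mean $\mu=\mathbb{E}W$. Write $\mathrm{Pn}(\lambda)$ for the Poisson distribution with mean $\lambda>0$. For an integer $k\ge 1$ and $Y\sim \mathrm{Pn}(\lambda)$, let $F(j)=\mathbb{P}(Y\le j)$, $\overline F(j)=\mathbb{P}(Y\ge j)$ and $$C_1(\lambda,k)=\frac{F(k-1)}{k\,\mathbb{P}(Y=k)}\left\{1-\min\left(\frac{F(k-2)}{F(k-1)}\cdot\frac{\lambda}{k-1},\ \frac{\overline F(k+1)}{\overline F(k)}\cdot\frac{k}{\lambda}\right)\right\},$$ $$C_2(\lambda,k)=\frac{F(k-1)}{k\,\mathbb{P}(Y=k)}\left(2-\frac{F(k-2)}{F(k-1)}\cdot\frac{\lambda}{k-1}-\frac{\overline F(k+1)}{\overline F(k)}\cdot\frac{k}{\lambda}\right),$$ where for $k=1$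 the term $\frac{F(k-2)}{F(k-1)}\cdot\frac{\lambda}{k-1}$ is read as $0$ (note $F(-1)=0$). (i) For every integer $k>\mu$, $$\left|\frac{\mathbb{P}(W\ge k)}{\mathrm{Pn}(\mu)([k,\infty))}-1\right|\le C_1(\mu,k)\,np^3(2-p).$$ (ii) Let $a=\lfloor np^3(3p-2)\rfloor$ and $\lambda=\mu-a$. For every integer $k>\lambda$, $$\left|\frac{\mathbb{P}(W-a\ge k)}{\mathrm{Pn}(\lambda)([k,\infty))}-1\right|\le C_2(\lambda,k)\,\frac{9.2\,np^2(1+5p)}{\sqrt{(n-8)(1-p)^3}}+C_1(\lambda,k)\,\min(1,\lambda).$$ -/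

import Mathlib

noncomputable section

/-- `Pn(lam)(A)`, the mass that the Poisson distribution with mean `lam` gives to a set `A` of
integers (for `0 ≤ lam`). -/
def poissonProb (lam : ℝ) (A : Set ℤ) : ℝ :=
  (ProbabilityTheory.poissonMeasure lam.toNNReal).real {m : ℕ | (m : ℤ) ∈ A}

/-- `F(j) = P(Y ≤ j)` for `Y ∼ Pn(lam)`; in particular `F(-1) = 0`. -/
def poissonLower (lam : ℝ) (j : ℤ) : ℝ := poissonProb lam (Set.Iic j)

/-- `P(Y ≥ j)` for `Y ∼ Pn(lam)`. -/
def poissonUpper (lam : ℝ) (j : ℤ) : ℝ := poissonProb lam (Set.Ici j)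

/-- The ratio `(F(k-2) / F(k-1)) * (lam / (k-1))`. For `k = 1` it is `0`, as `F(-1) = 0`. -/
def lowerTailRatio (lam : ℝ) (k : ℤ) : ℝ :=
  poissonLower lam (k - 2) / poissonLower lam (k - 1) * (lam / ((k : ℝ) - 1))

/-- The ratio `(P(Y ≥ k+1) / P(Y ≥ k)) * (k / lam)`. -/
def upperTailRatio (lam : ℝ) (k : ℤ) : ℝ :=
  poissonUpper lam (k + 1) / poissonUpper lam k * ((k : ℝ) / lam)

/-- The constant `C₁(lam, k)`. -/
def steinC1 (lam : ℝ) (k : ℤ) : ℝ :=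
  poissonLower lam (k - 1) / ((k : ℝ) * poissonProb lam {k}) *
    (1 - min (lowerTailRatio lam k) (upperTailRatio lam k))

/-- The constant `C₂(lam, k)`. -/
def steinC2 (lam : ℝ) (k : ℤ) : ℝ :=
  poissonLower lam (k - 1) / ((k : ℝ) * poissonProb lam {k}) *
    (2 - lowerTailRatio lam k - upperTailRatio lam k)

/-- The number of 2-runs `∑ i, ξ i * ξ (i + 1)`, the indices being read cyclically:
`finRotate n` sends `i` to `i + 1` modulo `n`. -/
def twoRuns {Ω : Type*} {n : ℕ} (ξ : Fin n → Ω → ℕ) (ω : Ω) : ℕ :=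
  ∑ i : Fin n, ξ i ω * ξ (finRotate n i) ω

end

/-! Stein's method for the Poisson law, applied to a tail indicator. With `K = k - 1` and `Q =
Pn(lam)([k, ∞))`, let `g` solve `lam * g j - j * g (j - 1) = 1[j ≥ k] - Q`. Taking means at `W - a`
and dividing by `Q` expresses the relative error through increments of `g`. On either side of `K`,
`g` is a multiple of a Mills ratio. By monotonicity and convexity of these ratios, its increments
are nonpositive before `K` and nonnegative after, and extreme next to `K`. The range of the
increments gives `steinC2` and their largest absolute value `steinC1`
(`exists_poissonStein_diff_bounds`).

By rotation invariance, `E[W g(W - a - 1)]` is `n` times the contribution of one run. Conditioning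
on four consecutive variables turns the Stein mean into an explicit combination of increments of
`g`, averaged over the number of 2-runs in the remaining path (`bernMean_stein`). The absolute
weights of these increments sum to `p (2 - p)`, which is (i).

For (ii), the signed weights sum to `-(2p - 3p²) = (μ - Var W) / μ`. The shift makes `lam` close to
`Var W` and cancels this sum up to the rounding in `a`, which costs the `steinC1` term. What is left
are second differences of path means and the effect of changing an end value of the path. Both are
of order `1/√n` by smoothing: the path count contains a conditionally binomial part, so the mean
increment of a bounded function is small (`abs_pathMean_diff_le`). -/

/-! ### Poisson masses and tails. -/

open MeasureTheory ProbabilityTheory in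
theorem poissonProb_singleton {lam : ℝ} (hlam : 0 < lam) (i : ℕ) :
    poissonProb lam {(i : ℤ)} = Real.exp (-lam) * lam ^ i / (Nat.factorial i : ℝ) := by
  have h : {m : ℕ | (m : ℤ) ∈ ({(i : ℤ)} : Set ℤ)} = {i} := by ext; simp
  rw [poissonProb, h, poissonMeasure_real_singleton, Real.coe_toNNReal _ hlam.le]

theorem poissonProb_singleton_pos {lam : ℝ} (hlam : 0 < lam) (i : ℕ) :
    0 < poissonProb lam {(i : ℤ)} := by
  rw [poissonProb_singleton hlam]; positivity

theorem poissonProb_singleton_succ {lam : ℝ} (hlam : 0 < lam) (i : ℕ) :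
    ((i : ℝ) + 1) * poissonProb lam {((i + 1 : ℕ) : ℤ)} = lam * poissonProb lam {(i : ℤ)} := by
  rw [poissonProb_singleton hlam, poissonProb_singleton hlam, Nat.factorial_succ]
  push_cast
  field_simp
  ring

theorem poissonLower_zero (lam : ℝ) : poissonLower lam 0 = poissonProb lam {((0 : ℕ) : ℤ)} := by
  unfold poissonLower poissonProb
  congr 1; ext m; simp

theorem poissonLower_succ (lam : ℝ) (i : ℕ) :
    poissonLower lam ((i + 1 : ℕ) : ℤ) =
      poissonLower lam (i : ℤ) + poissonProb lam {((i + 1 : ℕ) : ℤ)} := by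
  unfold poissonLower poissonProb
  rw [← MeasureTheory.measureReal_union _ (.of_discrete)]
  · congr 1; ext m; simp; lia
  · rw [Set.disjoint_left]; intro m; simp; lia

theorem poissonUpper_eq (lam : ℝ) (i : ℕ) :
    poissonUpper lam ((i + 1 : ℕ) : ℤ) = 1 - poissonLower lam (i : ℤ) := by
  unfold poissonLower poissonUpper poissonProb
  rw [← MeasureTheory.probReal_compl_eq_one_sub .of_discrete]
  congr 1; ext m; simp

theorem poissonLower_pos {lam : ℝ} (hlam : 0 < lam) (i : ℕ) : 0 < poissonLower lam (i : ℤ) := by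
  induction i with
  | zero => simpa [poissonLower_zero] using poissonProb_singleton_pos hlam 0
  | succ i ih => rw [poissonLower_succ]; linarith [poissonProb_singleton_pos hlam (i + 1)]

/-! ### Mills ratios: recurrences, monotonicity, convexity. -/

/-- `P(Y ≤ i) / (lam * P(Y = i))` for `Y ∼ Pn(lam)`. -/
noncomputable def lowerMills (lam : ℝ) (i : ℕ) : ℝ :=
  poissonLower lam (i : ℤ) / (lam * poissonProb lam {(i : ℤ)})

/-- The integral form of `P(Y > i) / (lam * P(Y = i))` for `Y ∼ Pn(lam)`. -/
noncomputable def upperMills (lam : ℝ) (i : ℕ) : ℝ :=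
  ∫ t in (0 : ℝ)..1, t ^ i * Real.exp (lam * (1 - t))

theorem poissonLower_eq_lowerMills {lam : ℝ} (hlam : 0 < lam) (i : ℕ) :
    poissonLower lam (i : ℤ) = lam * poissonProb lam {(i : ℤ)} * lowerMills lam i := by
  have := poissonProb_singleton_pos hlam i
  unfold lowerMills; field_simp

theorem lowerMills_zero {lam : ℝ} (hlam : 0 < lam) : lam * lowerMills lam 0 = 1 := by
  have h := poissonProb_singleton_pos hlam 0
  unfold lowerMills
  rw [Nat.cast_zero, poissonLower_zero]
  rw [Nat.cast_zero] at *
  field_simp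

theorem lowerMills_succ {lam : ℝ} (hlam : 0 < lam) (i : ℕ) :
    lam * lowerMills lam (i + 1) = ((i : ℝ) + 1) * lowerMills lam i + 1 := by
  have h0 := poissonProb_singleton_pos hlam i
  have h1 := poissonProb_singleton_pos hlam (i + 1)
  have h2 := poissonProb_singleton_succ hlam i
  unfold lowerMills
  rw [poissonLower_succ, ← h2]
  field_simp

theorem lowerMills_pos {lam : ℝ} (hlam : 0 < lam) (i : ℕ) : 0 < lowerMills lam i :=
  div_pos (poissonLower_pos hlam i) (mul_pos hlam (poissonProb_singleton_pos hlam i))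

theorem lowerMills_mono {lam : ℝ} (hlam : 0 < lam) (i : ℕ) :
    lowerMills lam i ≤ lowerMills lam (i + 1) := by
  refine le_of_mul_le_mul_left ?_ hlam
  induction i with
  | zero =>
    have := lowerMills_succ hlam 0
    have := lowerMills_zero hlam
    have := lowerMills_pos hlam 0
    norm_num at *
    linarith
  | succ i ih =>
    have h := le_of_mul_le_mul_left ih hlam
    rw [lowerMills_succ hlam i, lowerMills_succ hlam (i + 1)]
    push_cast
    have := lowerMills_pos hlam (i + 1)
    nlinarith

/-- With `u` the ratio and `Δ` its increments, the recurrence gives `lam * Δ (i + 1) = (i + 1) * Δ i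
+ u (i + 1)`, so monotonicity of `Δ` propagates from that of `u`. -/
theorem lowerMills_convex {lam : ℝ} (hlam : 0 < lam) (i : ℕ) :
    lowerMills lam (i + 1) - lowerMills lam i ≤ lowerMills lam (i + 2) - lowerMills lam (i + 1) := by
  refine le_of_mul_le_mul_left ?_ hlam
  induction i with
  | zero =>
    have h1 := lowerMills_succ hlam 0
    have h2 := lowerMills_succ hlam 1
    have := lowerMills_zero hlam
    have := lowerMills_mono hlam 0
    norm_num at *
    nlinarith
  | succ i ih =>
    have h := le_of_mul_le_mul_left ih hlam
    have h1 := lowerMills_succ hlam i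
    have h2 := lowerMills_succ hlam (i + 1)
    have h3 := lowerMills_succ hlam (i + 1 + 1)
    have h4 := lowerMills_mono hlam (i + 1)
    push_cast at h2 h3
    have h5 : (0 : ℝ) ≤ (i + 1) * ((lowerMills lam (i + 2) - lowerMills lam (i + 1)) -
      (lowerMills lam (i + 1) - lowerMills lam i)) := mul_nonneg (by positivity) (by linarith)
    rw [mul_sub, mul_sub]
    rw [show i + 1 + 2 = i + 1 + 1 + 1 from rfl, h3, h2, h1]
    rw [show i + 2 = i + 1 + 1 from rfl] at h5
    nlinarith

theorem lowerMills_diff_le {lam : ℝ} (hlam : 0 < lam) {i j : ℕ} (hij : i ≤ j) :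
    lowerMills lam (i + 1) - lowerMills lam i ≤ lowerMills lam (j + 1) - lowerMills lam j := by
  induction j, hij using Nat.le_induction with
  | base => exact le_rfl
  | succ j _ ih => exact ih.trans (lowerMills_convex hlam j)

theorem intervalIntegrable_upperMills (lam : ℝ) (i : ℕ) :
    IntervalIntegrable (fun t : ℝ => t ^ i * Real.exp (lam * (1 - t))) MeasureTheory.volume 0 1 := by
  apply Continuous.intervalIntegrable; fun_prop

theorem upperMills_pos (lam : ℝ) (i : ℕ) : 0 < upperMills lam i := by
  apply intervalIntegral.intervalIntegral_pos_of_pos_on (intervalIntegrable_upperMills lam i) _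
    one_pos
  intro t ht
  have := ht.1
  positivity

theorem upperMills_anti (lam : ℝ) (i : ℕ) : upperMills lam (i + 1) ≤ upperMills lam i := by
  apply intervalIntegral.integral_mono_on zero_le_one (intervalIntegrable_upperMills lam _)
    (intervalIntegrable_upperMills lam _)
  intro t ht
  have := pow_le_pow_of_le_one ht.1 ht.2 (Nat.le_succ i)
  gcongr

/-- The integral form pays off here: for `t` in `[0, 1]` the powers `t ^ i` are convex in `i`, with
second difference `t ^ i * (1 - t) ^ 2`. -/
theorem upperMills_convex (lam : ℝ) (i : ℕ) :
    upperMills lam (i + 1) - upperMills lam (i + 2) ≤ upperMills lam i - upperMills lam (i + 1) := by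
  unfold upperMills
  have h := intervalIntegrable_upperMills lam
  rw [← intervalIntegral.integral_sub (h _) (h _), ← intervalIntegral.integral_sub (h _) (h _)]
  apply intervalIntegral.integral_mono_on zero_le_one ((h _).sub (h _)) ((h _).sub (h _))
  intro t ht
  have h0 : 0 ≤ t ^ i * Real.exp (lam * (1 - t)) * (1 - t) ^ 2 := by
    have := ht.1
    positivity
  have e : t ^ i * Real.exp (lam * (1 - t)) * (1 - t) ^ 2 =
    (t ^ i * Real.exp (lam * (1 - t)) - t ^ (i + 1) * Real.exp (lam * (1 - t))) -
    (t ^ (i + 1) * Real.exp (lam * (1 - t)) - t ^ (i + 2) * Real.exp (lam * (1 - t))) := by ring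
  linarith

theorem upperMills_diff_le (lam : ℝ) {i j : ℕ} (hij : i ≤ j) :
    upperMills lam j - upperMills lam (j + 1) ≤ upperMills lam i - upperMills lam (i + 1) := by
  induction j, hij using Nat.le_induction with
  | base => exact le_rfl
  | succ j _ ih => exact (upperMills_convex lam j).trans ih

theorem upperMills_zero (lam : ℝ) : lam * upperMills lam 0 = Real.exp lam - 1 := by
  unfold upperMills
  have h : ∀ t ∈ Set.uIcc (0 : ℝ) 1, HasDerivAt (fun t : ℝ => -Real.exp (lam * (1 - t)))
      (lam * (t ^ 0 * Real.exp (lam * (1 - t)))) t := by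
    intro t _
    have := ((((hasDerivAt_id t).const_sub 1).const_mul lam).exp).neg
    convert! this using 1
    simp; ring
  rw [← intervalIntegral.integral_const_mul, intervalIntegral.integral_eq_sub_of_hasDerivAt h
    ((intervalIntegrable_upperMills lam 0).const_mul lam)]
  simp; ring

theorem upperMills_succ (lam : ℝ) (i : ℕ) :
    ((i : ℝ) + 1) * upperMills lam i = 1 + lam * upperMills lam (i + 1) := by
  unfold upperMills
  have h : ∀ t ∈ Set.uIcc (0 : ℝ) 1, HasDerivAt (fun t : ℝ => t ^ (i + 1) * Real.exp (lam * (1 - t)))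
      (((i : ℝ) + 1) * (t ^ i * Real.exp (lam * (1 - t))) -
        lam * (t ^ (i + 1) * Real.exp (lam * (1 - t)))) t := by
    intro t _
    have := (hasDerivAt_pow (i + 1) t).mul ((((hasDerivAt_id t).const_sub 1).const_mul lam).exp)
    convert! this using 1
    simp; ring
  have h1 := (intervalIntegrable_upperMills lam i).const_mul ((i : ℝ) + 1)
  have h2 := (intervalIntegrable_upperMills lam (i + 1)).const_mul lam
  have := intervalIntegral.integral_eq_sub_of_hasDerivAt h (h1.sub h2)
  rw [intervalIntegral.integral_sub h1 h2, intervalIntegral.integral_const_mul,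
    intervalIntegral.integral_const_mul] at this
  simp at this
  linarith

theorem poissonUpper_eq_upperMills {lam : ℝ} (hlam : 0 < lam) (i : ℕ) :
    poissonUpper lam ((i + 1 : ℕ) : ℤ) = lam * poissonProb lam {(i : ℤ)} * upperMills lam i := by
  induction i with
  | zero =>
    rw [poissonUpper_eq, Nat.cast_zero, poissonLower_zero, mul_right_comm, upperMills_zero,
      ← Nat.cast_zero (R := ℤ), poissonProb_singleton hlam]
    have : Real.exp lam * Real.exp (-lam) = 1 := by rw [← Real.exp_add]; simp
    simp
    linarith
  | succ i ih =>
    have h1 := poissonProb_singleton_succ hlam i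
    have h2 := upperMills_succ lam i
    have h3 : poissonUpper lam ((i + 1 + 1 : ℕ) : ℤ) =
        poissonUpper lam ((i + 1 : ℕ) : ℤ) - poissonProb lam {((i + 1 : ℕ) : ℤ)} := by
      rw [poissonUpper_eq, poissonUpper_eq, poissonLower_succ]; ring
    rw [h3, ih, ← h1]
    linear_combination (poissonProb lam {((i + 1 : ℕ) : ℤ)}) * h2

theorem poissonUpper_pos {lam : ℝ} (hlam : 0 < lam) (i : ℕ) :
    0 < poissonUpper lam ((i + 1 : ℕ) : ℤ) := by
  rw [poissonUpper_eq_upperMills hlam]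
  have := poissonProb_singleton_pos hlam i
  have := upperMills_pos lam i
  positivity

theorem upperTailRatio_eq {lam : ℝ} (hlam : 0 < lam) (i : ℕ) :
    upperTailRatio lam ((i + 1 : ℕ) : ℤ) = upperMills lam (i + 1) / upperMills lam i := by
  have h0 := poissonProb_singleton_pos hlam i
  have h1 := poissonProb_singleton_succ hlam i
  have h2 := poissonProb_singleton_pos hlam (i + 1)
  have h3 := upperMills_pos lam i
  unfold upperTailRatio
  rw [show ((i + 1 : ℕ) : ℤ) + 1 = ((i + 1 + 1 : ℕ) : ℤ) by push_cast; rfl,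
    poissonUpper_eq_upperMills hlam, poissonUpper_eq_upperMills hlam, ← h1]
  push_cast at *
  field_simp

theorem lowerTailRatio_one (lam : ℝ) : lowerTailRatio lam ((0 + 1 : ℕ) : ℤ) = 0 := by
  simp [lowerTailRatio]

theorem lowerTailRatio_succ {lam : ℝ} (hlam : 0 < lam) (i : ℕ) :
    lowerTailRatio lam ((i + 1 + 1 : ℕ) : ℤ) = lowerMills lam i / lowerMills lam (i + 1) := by
  have h0 := poissonProb_singleton_pos hlam i
  have h1 := poissonProb_singleton_succ hlam i
  have h2 := poissonProb_singleton_pos hlam (i + 1)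
  have h3 := lowerMills_pos hlam (i + 1)
  unfold lowerTailRatio
  rw [show ((i + 1 + 1 : ℕ) : ℤ) - 2 = ((i : ℕ) : ℤ) by push_cast; ring,
    show ((i + 1 + 1 : ℕ) : ℤ) - 1 = ((i + 1 : ℕ) : ℤ) by push_cast; ring,
    poissonLower_eq_lowerMills hlam, poissonLower_eq_lowerMills hlam, ← h1]
  push_cast at *
  rw [add_sub_cancel_right]
  field_simp

theorem steinFactor_eq {lam : ℝ} (hlam : 0 < lam) (K : ℕ) :
    poissonLower lam (((K + 1 : ℕ) : ℤ) - 1) /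
      ((((K + 1 : ℕ) : ℤ) : ℝ) * poissonProb lam {((K + 1 : ℕ) : ℤ)}) = lowerMills lam K := by
  have h := poissonProb_singleton_succ hlam K
  rw [show ((K + 1 : ℕ) : ℤ) - 1 = (K : ℤ) by push_cast; ring, lowerMills, ← h]
  push_cast
  rfl

/-! ### The Stein equation and the increments of its solution. -/

/-- The solution of the Poisson Stein equation for `[K + 1, ∞)`, shifted by one. -/
noncomputable def poissonStein (lam : ℝ) (K i : ℕ) : ℝ :=
  if i ≤ K then -(poissonUpper lam ((K + 1 : ℕ) : ℤ) * lowerMills lam i)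
  else -((1 - poissonUpper lam ((K + 1 : ℕ) : ℤ)) * upperMills lam i)

theorem poissonStein_of_le (lam : ℝ) {K i : ℕ} (h : i ≤ K) :
    poissonStein lam K i = -(poissonUpper lam ((K + 1 : ℕ) : ℤ) * lowerMills lam i) := if_pos h

/-- Both sides equal `Q (1 - Q) / (lam * P(Y = K))`. Hence the two branches of `poissonStein` agree
at `K`, and each increment lies within a single branch. -/
theorem mills_match {lam : ℝ} (hlam : 0 < lam) (K : ℕ) :
    poissonUpper lam ((K + 1 : ℕ) : ℤ) * lowerMills lam K =
      (1 - poissonUpper lam ((K + 1 : ℕ) : ℤ)) * upperMills lam K := by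
  have h0 := poissonUpper_eq_upperMills hlam K
  have h1 := poissonLower_eq_lowerMills hlam K
  rw [← sub_sub_cancel 1 (poissonLower lam (K : ℤ)), ← poissonUpper_eq] at h1
  rw [h1, h0]; ring

theorem poissonStein_of_ge {lam : ℝ} (hlam : 0 < lam) {K i : ℕ} (h : K ≤ i) :
    poissonStein lam K i = -((1 - poissonUpper lam ((K + 1 : ℕ) : ℤ)) * upperMills lam i) := by
  rcases h.eq_or_lt with rfl | h
  · rw [poissonStein_of_le lam le_rfl, mills_match hlam]
  · exact if_neg (by lia)

theorem poissonStein_equation {lam : ℝ} (hlam : 0 < lam) (K j : ℕ) :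
    lam * poissonStein lam K j - j * poissonStein lam K (j - 1) =
      (if K + 1 ≤ j then 1 else 0) - poissonUpper lam ((K + 1 : ℕ) : ℤ) := by
  rcases j with _ | j
  -- At `j = 0` the truncated `j - 1` is harmless, being multiplied by `0`.
  · rw [poissonStein_of_le lam (Nat.zero_le K), if_neg (by lia)]
    have := lowerMills_zero hlam
    generalize poissonUpper lam ((K + 1 : ℕ) : ℤ) = Q
    push_cast
    linear_combination (-Q) * this
  · rw [Nat.add_sub_cancel]
    by_cases h : K ≤ j
    · rw [poissonStein_of_ge hlam h, poissonStein_of_ge hlam (h.trans (Nat.le_succ j)),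
        if_pos (by lia)]
      have := upperMills_succ lam j
      generalize poissonUpper lam ((K + 1 : ℕ) : ℤ) = Q
      push_cast
      linear_combination (1 - Q) * this
    · rw [poissonStein_of_le lam (by lia : j ≤ K), poissonStein_of_le lam (by lia : j + 1 ≤ K),
        if_neg (by lia)]
      have := lowerMills_succ hlam j
      generalize poissonUpper lam ((K + 1 : ℕ) : ℤ) = Q
      push_cast
      linear_combination (-Q) * this

/-- The differences of the Stein solution lie in an interval `[lo, hi]` around `0`, the endpoints
of which give the constants `steinC1` and `steinC2`. -/
theorem exists_poissonStein_diff_bounds {lam : ℝ} (hlam : 0 < lam) (K : ℕ) :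
    ∃ lo hi : ℝ, (∀ j, lo ≤ poissonStein lam K (j + 1) - poissonStein lam K j) ∧
      (∀ j, poissonStein lam K (j + 1) - poissonStein lam K j ≤ hi) ∧
      hi - lo = steinC2 lam ((K + 1 : ℕ) : ℤ) * poissonUpper lam ((K + 1 : ℕ) : ℤ) ∧
      (∀ j, |poissonStein lam K (j + 1) - poissonStein lam K j| ≤
        steinC1 lam ((K + 1 : ℕ) : ℤ) * poissonUpper lam ((K + 1 : ℕ) : ℤ)) := by
  have hm := mills_match hlam K
  have hQpos := poissonUpper_pos hlam K
  have hF : 0 < 1 - poissonUpper lam ((K + 1 : ℕ) : ℤ) := by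
    rw [poissonUpper_eq, sub_sub_cancel]; exact poissonLower_pos hlam K
  have hv := upperMills_pos lam K
  have hu := lowerMills_pos hlam K
  unfold steinC1 steinC2
  rw [steinFactor_eq hlam, upperTailRatio_eq hlam]
  set Q := poissonUpper lam ((K + 1 : ℕ) : ℤ) with hQ
  set r := lowerTailRatio lam ((K + 1 : ℕ) : ℤ) with hr
  set s := upperMills lam (K + 1) / upperMills lam K with hs
  have hhi : lowerMills lam K * Q * (1 - s) =
      (1 - Q) * (upperMills lam K - upperMills lam (K + 1)) := by
    rw [mul_comm (lowerMills lam K), hm, hs]; field_simp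
  have hlo0 : 0 ≤ 1 - r := by
    rcases K with _ | K
    · rw [hr, lowerTailRatio_one]; norm_num
    · rw [hr, lowerTailRatio_succ hlam, sub_nonneg, div_le_one hu]
      exact lowerMills_mono hlam K
  have hhi0 : 0 ≤ 1 - s := by
    rw [hs, sub_nonneg, div_le_one hv]
    exact upperMills_anti lam K
  have hpos : 0 < lowerMills lam K * Q := mul_pos hu hQpos
  -- Increments from `K` on are nonnegative; before `K`, convexity makes the last one the smallest.
  have h1 : ∀ j, -(lowerMills lam K * Q * (1 - r)) ≤
      poissonStein lam K (j + 1) - poissonStein lam K j := by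
    intro j
    by_cases h : K ≤ j
    · rw [poissonStein_of_ge hlam h, poissonStein_of_ge hlam (h.trans (Nat.le_succ j))]
      have h2 := mul_nonneg hF.le (sub_nonneg.2 (upperMills_anti lam j))
      have h3 := mul_nonneg hpos.le hlo0
      linarith
    · rw [poissonStein_of_le lam (by lia : j ≤ K), poissonStein_of_le lam (by lia : j + 1 ≤ K)]
      rcases K with _ | K
      · lia
      · rw [hr, lowerTailRatio_succ hlam]
        have h2 := mul_le_mul_of_nonneg_left (lowerMills_diff_le hlam (by lia : j ≤ K)) hQpos.le
        have h3 : lowerMills lam (K + 1) * Q * (1 - lowerMills lam K / lowerMills lam (K + 1)) =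
            Q * (lowerMills lam (K + 1) - lowerMills lam K) := by field_simp
        rw [h3]
        linarith
  have h2 : ∀ j, poissonStein lam K (j + 1) - poissonStein lam K j ≤
      lowerMills lam K * Q * (1 - s) := by
    intro j
    by_cases h : K ≤ j
    · rw [poissonStein_of_ge hlam h, poissonStein_of_ge hlam (h.trans (Nat.le_succ j)), hhi]
      have h2 := mul_le_mul_of_nonneg_left (upperMills_diff_le lam h) hF.le
      linarith
    · rw [poissonStein_of_le lam (by lia : j ≤ K), poissonStein_of_le lam (by lia : j + 1 ≤ K)]
      have h2 := mul_nonneg hQpos.le (sub_nonneg.2 (lowerMills_mono hlam j))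
      have h3 := mul_nonneg hpos.le hhi0
      linarith
  refine ⟨_, _, h1, h2, by ring, fun j => ?_⟩
  have e : lowerMills lam K * (1 - min r s) * Q = lowerMills lam K * Q * (1 - min r s) := by ring
  rw [e, abs_le]
  have hr' := mul_le_mul_of_nonneg_left (sub_le_sub_left (min_le_left r s) 1) hpos.le
  have hs' := mul_le_mul_of_nonneg_left (sub_le_sub_left (min_le_right r s) 1) hpos.le
  exact ⟨by linarith [h1 j], by linarith [h2 j]⟩

/-! ### Binomial means and 2-runs on a path with fixed end values. -/

/-- The mean of `G` under the binomial distribution with parameters `N` and `p`. -/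
noncomputable def binMean (p : ℝ) : ℕ → (ℕ → ℝ) → ℝ
  | 0, G => G 0
  | N + 1, G => p * binMean p N (fun j => G (j + 1)) + (1 - p) * binMean p N G

/-- The mean of `G (b * x₁ + x₁ * x₂ + ⋯ + xₘ * a)` for independent Bernoulli variables `xᵢ`
with success probability `p`. -/
noncomputable def pathMean (p : ℝ) : ℕ → ℕ → ℕ → (ℕ → ℝ) → ℝ
  | 0, b, a, G => G (b * a)
  | m + 1, b, a, G => p * pathMean p m 1 a (fun j => G (b + j)) + (1 - p) * pathMean p m 0 a G

theorem binMean_add (p : ℝ) (N : ℕ) (G H : ℕ → ℝ) :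
    binMean p N (fun j => G j + H j) = binMean p N G + binMean p N H := by
  induction N generalizing G H with
  | zero => rfl
  | succ N ih => simp only [binMean, ih]; ring

theorem binMean_mul_left (p c : ℝ) (N : ℕ) (G : ℕ → ℝ) :
    binMean p N (fun j => c * G j) = c * binMean p N G := by
  induction N generalizing G with
  | zero => rfl
  | succ N ih => simp only [binMean, ih]; ring

theorem binMean_const (p c : ℝ) (N : ℕ) : binMean p N (fun _ => c) = c := by
  induction N with
  | zero => rfl
  | succ N ih => simp only [binMean, ih]; ring

theorem binMean_mono {p : ℝ} (hp0 : 0 ≤ p) (hp1 : p ≤ 1) (N : ℕ) {G H : ℕ → ℝ}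
    (h : ∀ j, G j ≤ H j) : binMean p N G ≤ binMean p N H := by
  induction N generalizing G H with
  | zero => exact h 0
  | succ N ih =>
    exact add_le_add (mul_le_mul_of_nonneg_left (ih fun j => h (j + 1)) hp0)
      (mul_le_mul_of_nonneg_left (ih h) (sub_nonneg.2 hp1))

theorem pathMean_add (p : ℝ) (m b a : ℕ) (G H : ℕ → ℝ) :
    pathMean p m b a (fun j => G j + H j) = pathMean p m b a G + pathMean p m b a H := by
  induction m generalizing b G H with
  | zero => rfl
  | succ m ih => simp only [pathMean, ih]; ring

theorem pathMean_mul_left (p c : ℝ) (m b a : ℕ) (G : ℕ → ℝ) :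
    pathMean p m b a (fun j => c * G j) = c * pathMean p m b a G := by
  induction m generalizing b G with
  | zero => rfl
  | succ m ih => simp only [pathMean, ih]; ring

theorem pathMean_sub (p : ℝ) (m b a : ℕ) (G H : ℕ → ℝ) :
    pathMean p m b a (fun j => G j - H j) = pathMean p m b a G - pathMean p m b a H := by
  induction m generalizing b G H with
  | zero => rfl
  | succ m ih => simp only [pathMean, ih]; ring

theorem pathMean_const (p c : ℝ) (m b a : ℕ) : pathMean p m b a (fun _ => c) = c := by
  induction m generalizing b with
  | zero => rfl
  | succ m ih => simp only [pathMean, ih]; ring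

theorem abs_pathMean_le {p : ℝ} (hp0 : 0 ≤ p) (hp1 : p ≤ 1) (m b a : ℕ) {G : ℕ → ℝ} {C : ℝ}
    (h : ∀ j, |G j| ≤ C) : |pathMean p m b a G| ≤ C := by
  induction m generalizing b G with
  | zero => exact h _
  | succ m ih =>
    have h1 := abs_le.1 (ih 1 (fun j => h (b + j)))
    have h2 := abs_le.1 (ih 0 h)
    simp only [pathMean]
    rw [abs_le]
    constructor <;> nlinarith

theorem pathMean_succ_right (p : ℝ) (m b a : ℕ) (G : ℕ → ℝ) :
    pathMean p (m + 1) b a G =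
      p * pathMean p m b 1 (fun j => G (j + a)) + (1 - p) * pathMean p m b 0 G := by
  induction m generalizing b G with
  | zero => simp [pathMean]
  | succ m ih =>
    rw [pathMean, ih, ih]
    simp only [pathMean, add_assoc]
    ring

theorem pathMean_comm (p : ℝ) (m b a : ℕ) (G : ℕ → ℝ) :
    pathMean p m b a G = pathMean p m a b G := by
  induction m generalizing b a G with
  | zero => simp [pathMean, mul_comm]
  | succ m ih =>
    rw [pathMean_succ_right, pathMean, ih b 1, ih b 0]
    simp only [add_comm a]

/-- The end value matters only if its neighbour is `1`, and then it adds exactly one run. -/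
theorem pathMean_one_sub_zero_right (p : ℝ) (m b : ℕ) (G : ℕ → ℝ) :
    pathMean p (m + 1) b 1 G - pathMean p (m + 1) b 0 G =
      p * pathMean p m b 1 (fun j => G (j + 1) - G j) := by
  rw [pathMean_succ_right, pathMean_succ_right, pathMean_sub]
  simp only [add_zero]
  ring

/-! ### Smoothing estimates. -/

/-- Integration by parts for the binomial distribution. -/
theorem binMean_score (p : ℝ) (N : ℕ) (G : ℕ → ℝ) :
    binMean p (N + 1) (fun j => ((j : ℝ) - (N + 1) * p) * G j) =
      (N + 1) * p * (1 - p) * binMean p N (fun j => G (j + 1) - G j) := by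
  induction N generalizing G with
  | zero => simp [binMean]; ring
  | succ N ih =>
    rw [binMean]
    have e1 : (fun j : ℕ => (((j + 1 : ℕ) : ℝ) - ((N + 1 : ℕ) + 1) * p) * G (j + 1)) =
        fun j : ℕ => ((j : ℝ) - (N + 1) * p) * G (j + 1) + (1 - p) * G (j + 1) := by
      funext j; push_cast; ring
    have e2 : (fun j : ℕ => ((j : ℝ) - ((N + 1 : ℕ) + 1) * p) * G j) =
        fun j : ℕ => ((j : ℝ) - (N + 1) * p) * G j + (-p) * G j := by
      funext j; push_cast; ring
    have e3 : (fun j => G (j + 1) - G j) = fun j => G (j + 1) + (-1) * G j := by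
      funext j; ring
    rw [e1, e2, binMean_add, binMean_add, ih (fun j => G (j + 1)), ih G, binMean_mul_left,
      binMean_mul_left, e3, binMean_add, binMean_mul_left]
    have e4 : (fun j => G (j + 1 + 1) - G (j + 1)) =
      fun j => G (j + 1 + 1) + (-1) * G (j + 1) := by funext j; ring
    rw [e4, binMean_add, binMean_mul_left, binMean_add, binMean_mul_left]
    simp only [binMean]
    push_cast
    ring

theorem binMean_variance (p : ℝ) (N : ℕ) :
    binMean p (N + 1) (fun j => ((j : ℝ) - (N + 1) * p) ^ 2) = (N + 1) * p * (1 - p) := by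
  have h := binMean_score p N (fun j => (j : ℝ) - (N + 1) * p)
  have e : (fun j : ℕ => (((j + 1 : ℕ) : ℝ) - (N + 1) * p) - ((j : ℝ) - (N + 1) * p)) =
    fun _ => 1 := by funext j; push_cast; ring
  simp only [e, binMean_const] at h
  simpa [sq] using h

theorem abs_binMean_le {p : ℝ} (hp0 : 0 ≤ p) (hp1 : p ≤ 1) (N : ℕ) {G H : ℕ → ℝ}
    (h : ∀ j, |G j| ≤ H j) : |binMean p N G| ≤ binMean p N H := by
  rw [abs_le]
  constructor
  · rw [neg_eq_neg_one_mul, ← binMean_mul_left]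
    exact binMean_mono hp0 hp1 N fun j => by linarith [neg_le_of_abs_le (h j)]
  · exact binMean_mono hp0 hp1 N fun j => le_of_abs_le (h j)

/-- Integration by parts reduces this to bounding the mean absolute deviation by the standard
deviation `s`; the inequality `|x| ≤ s / 2 + x ^ 2 / (2 * s)` stands in for Cauchy–Schwarz. -/
theorem abs_binMean_diff_le {p : ℝ} (hp0 : 0 < p) (hp1 : p < 1) (N : ℕ) {G : ℕ → ℝ} {R : ℝ}
    (h : ∀ j, |G j| ≤ R) :
    |binMean p N (fun j => G (j + 1) - G j)| ≤ R / √((N + 1) * (p * (1 - p))) := by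
  have hq : 0 < p * (1 - p) := mul_pos hp0 (sub_pos.2 hp1)
  have hR : 0 ≤ R := (abs_nonneg _).trans (h 0)
  set s := √((N + 1) * (p * (1 - p))) with hs
  have hs0 : 0 < s := Real.sqrt_pos.2 (by positivity)
  have hs2 : s ^ 2 = (N + 1) * (p * (1 - p)) := Real.sq_sqrt (by positivity)
  have h1 : |binMean p (N + 1) (fun j => ((j : ℝ) - (N + 1) * p) * G j)| ≤
      binMean p (N + 1) (fun j => R * s / 2 + R / (2 * s) * ((j : ℝ) - (N + 1) * p) ^ 2) := by
    apply abs_binMean_le hp0.le hp1.le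
    intro j
    generalize (j : ℝ) - (N + 1) * p = x
    rw [abs_mul]
    have h2 : |x| ≤ s / 2 + 1 / (2 * s) * x ^ 2 := by
      have e : s / 2 + 1 / (2 * s) * x ^ 2 - |x| = (s - |x|) ^ 2 / (2 * s) := by
        rw [sub_sq, sq_abs]; field_simp
        ring
      have : 0 ≤ (s - |x|) ^ 2 / (2 * s) := by positivity
      linarith
    calc |x| * |G j| ≤ (s / 2 + 1 / (2 * s) * x ^ 2) * R :=
          mul_le_mul h2 (h j) (abs_nonneg _) (by positivity)
      _ = _ := by ring
  rw [binMean_score, binMean_add, binMean_const, binMean_mul_left, binMean_variance, mul_assoc _ p,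
    ← hs2, abs_mul, abs_of_pos (by positivity)] at h1
  rw [le_div_iff₀ hs0]
  have h3 : R * s / 2 + R / (2 * s) * s ^ 2 = R * s := by field_simp; ring
  rw [h3] at h1
  nlinarith

/-- Size biasing, `E[J H(J)] = (k + 1) q E[H(J' + 1)]`, with `H j = 1 / j`; the left side is at most
`1`, since `0 * (1 / 0) = 0`. -/
theorem binMean_inv_succ_le {q : ℝ} (hq0 : 0 < q) (hq1 : q ≤ 1) (k : ℕ) :
    binMean q k (fun j => 1 / ((j : ℝ) + 1)) ≤ 1 / ((k + 1) * q) := by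
  have h : ∀ (k : ℕ) (H : ℕ → ℝ), binMean q (k + 1) (fun j => (j : ℝ) * H j) =
      (k + 1) * q * binMean q k (fun j => H (j + 1)) := by
    intro k
    induction k with
    | zero => intro H; simp [binMean]
    | succ k ih =>
      intro H
      have e : (fun j : ℕ => ((j + 1 : ℕ) : ℝ) * H (j + 1)) =
          fun j : ℕ => (j : ℝ) * H (j + 1) + H (j + 1) := by
        funext j; push_cast; ring
      rw [binMean, e, binMean_add, ih, ih]
      simp only [binMean]
      push_cast
      ring
  have h1 := h k (fun j => 1 / (j : ℝ))
  have h2 : binMean q (k + 1) (fun j => (j : ℝ) * (1 / (j : ℝ))) ≤ 1 := by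
    refine (binMean_mono hq0.le hq1 _ fun j => ?_).trans_eq (binMean_const q 1 (k + 1))
    rw [mul_one_div]; exact div_self_le_one _
  rw [h1] at h2
  push_cast at h2
  rw [le_div_iff₀ (by positivity)]
  linarith

/-- Jensen's inequality from the previous lemma, via `x ≤ t / 2 + x ^ 2 / (2 * t)` with `t` the
target bound. -/
theorem binMean_inv_sqrt_le {q : ℝ} (hq0 : 0 < q) (hq1 : q ≤ 1) (k : ℕ) :
    binMean q k (fun j => 1 / √(((j : ℝ) + 1) * q)) ≤ 1 / (q * √(k + 1)) := by
  set t := 1 / (q * √((k : ℝ) + 1)) with ht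
  have hk : (√((k : ℝ) + 1)) ^ 2 = k + 1 := Real.sq_sqrt (by positivity)
  have hk0 : 0 < √((k : ℝ) + 1) := Real.sqrt_pos.2 (by positivity)
  have ht0 : 0 < t := by positivity
  have ht2 : t ^ 2 = 1 / ((k + 1) * q) / q := by
    rw [ht, div_pow, mul_pow, hk]; field_simp
  calc binMean q k (fun j => 1 / √(((j : ℝ) + 1) * q))
      ≤ binMean q k (fun j => t / 2 + 1 / (2 * t * q) * (1 / ((j : ℝ) + 1))) := by
        refine binMean_mono hq0.le hq1 _ fun j => ?_
        set x := 1 / √(((j : ℝ) + 1) * q) with hx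
        have hx2 : x ^ 2 = 1 / (((j : ℝ) + 1) * q) := by
          rw [hx, div_pow, Real.sq_sqrt (by positivity), one_pow]
        have e : t / 2 + 1 / (2 * t * q) * (1 / ((j : ℝ) + 1)) - x = (t - x) ^ 2 / (2 * t) := by
          have : 1 / (2 * t * q) * (1 / ((j : ℝ) + 1)) = x ^ 2 / (2 * t) := by
            rw [hx2]; field_simp
          rw [this]; field_simp; ring
        have : 0 ≤ (t - x) ^ 2 / (2 * t) := by positivity
        linarith
    _ ≤ t := by
        rw [binMean_add, binMean_const, binMean_mul_left]
        have h := mul_le_mul_of_nonneg_left (binMean_inv_succ_le hq0 hq1 k)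
          (by positivity : 0 ≤ 1 / (2 * t * q))
        have e : 1 / (2 * t * q) * (1 / ((k + 1) * q)) = t / 2 := by
          have : 1 / ((k + 1) * q) = t ^ 2 * q := by rw [ht2]; field_simp
          rw [this]; field_simp
        linarith

/-- Smoothing by the variables whose two neighbours are `1` and `0`, one in each block of three. -/
theorem abs_pathMean_binMean_diff_le {p : ℝ} (hp0 : 0 < p) (hp1 : p < 1) (k r b a N : ℕ)
    {G : ℕ → ℝ} {R : ℝ} (h : ∀ j, |G j| ≤ R) :
    |pathMean p (3 * k + r) b a (fun s => binMean p N (fun j => G (s + j + 1) - G (s + j)))| ≤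
      binMean (p * (1 - p)) k (fun j => R / √(((j + N : ℕ) + 1) * (p * (1 - p)))) := by
  have hq0 : 0 < 1 - p := sub_pos.2 hp1
  induction k generalizing b N G with
  | zero =>
    simp only [binMean, Nat.zero_add]
    exact abs_pathMean_le hp0.le hp1.le _ _ _ fun s =>
      abs_binMean_diff_le hp0 hp1 N (G := fun j => G (s + j)) fun j => h _
  | succ k ih =>
    rw [show 3 * (k + 1) + r = 3 * k + r + 1 + 1 + 1 by ring]
    set D := fun (c s : ℕ) => binMean p N (fun j => G (c + s + j + 1) - G (c + s + j)) with hD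
    have hI : ∀ c b, |pathMean p (3 * k + r) b a (D c)| ≤
        binMean (p * (1 - p)) k (fun j => R / √(((j + N : ℕ) + 1) * (p * (1 - p)))) := by
      intro c b
      have := ih b N (G := fun j => G (c + j)) (fun j => h _)
      simpa only [hD, add_assoc] using this
    have hF := ih 0 (N + 1) (G := fun j => G (b + j)) (fun j => h _)
    have hFe : pathMean p (3 * k + r) 0 a
        (fun s => binMean p (N + 1) (fun j => G (b + (s + j + 1)) - G (b + (s + j)))) =
        p * pathMean p (3 * k + r) 0 a (D (b + 1)) +
          (1 - p) * pathMean p (3 * k + r) 0 a (D b) := by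
      rw [← pathMean_mul_left, ← pathMean_mul_left, ← pathMean_add]
      congr 1
      funext s
      simp only [hD, binMean]
      congr 3 <;> funext j <;> congr 2 <;> ring
    -- Of the eight values of the next block, `1,0,0` and `1,1,0` are kept together: there the
    -- middle variable is a free Bernoulli summand and joins the binomial part, raising `N` by one.
    -- Such blocks have probability `p * (1 - p)`, whence the outer binomial mean.
    have hT : pathMean p (3 * k + r + 1 + 1 + 1) b a
        (fun s => binMean p N (fun j => G (s + j + 1) - G (s + j))) =
        p * p * p * pathMean p (3 * k + r) 1 a (D (b + 1 + 1)) +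
        p * (1 - p) * (p * pathMean p (3 * k + r) 0 a (D (b + 1)) +
          (1 - p) * pathMean p (3 * k + r) 0 a (D b)) +
        p * (1 - p) * p * pathMean p (3 * k + r) 1 a (D b) +
        (1 - p) * p * p * pathMean p (3 * k + r) 1 a (D 1) +
        (1 - p) * p * (1 - p) * pathMean p (3 * k + r) 0 a (D 0) +
        (1 - p) * (1 - p) * p * pathMean p (3 * k + r) 1 a (D 0) +
        (1 - p) * (1 - p) * (1 - p) * pathMean p (3 * k + r) 0 a (D 0) := by
      simp only [pathMean, hD, zero_add, add_assoc]
      ring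
    rw [hT, ← hFe]
    simp only [binMean]
    set E0 := binMean (p * (1 - p)) k (fun j => R / √(((j + N : ℕ) + 1) * (p * (1 - p))))
    have e1 : (fun j : ℕ => R / √(((j + 1 + N : ℕ) + 1) * (p * (1 - p)))) =
        fun j : ℕ => R / √(((j + (N + 1) : ℕ) + 1) * (p * (1 - p))) := by
      funext j; rw [show j + 1 + N = j + (N + 1) by ring]
    rw [e1]
    simp only [binMean] at hF
    set E1 := binMean (p * (1 - p)) k (fun j => R / √(((j + (N + 1) : ℕ) + 1) * (p * (1 - p))))
    have key : ∀ w x E : ℝ, 0 ≤ w → |x| ≤ E → |w * x| ≤ w * E := fun w x E hw hx => by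
      rw [abs_mul, abs_of_nonneg hw]; exact mul_le_mul_of_nonneg_left hx hw
    have k1 := key (p * p * p) _ _ (by positivity) (hI (b + 1 + 1) 1)
    have k2 := key (p * (1 - p)) _ _ (by positivity) hF
    have k3 := key (p * (1 - p) * p) _ _ (by positivity) (hI b 1)
    have k4 := key ((1 - p) * p * p) _ _ (by positivity) (hI 1 1)
    have k5 := key ((1 - p) * p * (1 - p)) _ _ (by positivity) (hI 0 0)
    have k6 := key ((1 - p) * (1 - p) * p) _ _ (by positivity) (hI 0 1)
    have k7 := key ((1 - p) * (1 - p) * (1 - p)) _ _ (by positivity) (hI 0 0)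
    refine (abs_add_le _ _).trans ((add_le_add ((abs_add_le _ _).trans (add_le_add
      ((abs_add_le _ _).trans (add_le_add ((abs_add_le _ _).trans (add_le_add
      ((abs_add_le _ _).trans (add_le_add ((abs_add_le _ _).trans (add_le_add k1 k2)) k3)) k4))
      k5)) k6)) k7).trans (le_of_eq ?_))
    ring

/-- Centring `G` at the midpoint of its range leaves the increments unchanged and makes half the
range its bound. -/
theorem abs_pathMean_diff_le {p : ℝ} (hp0 : 0 < p) (hp1 : p < 1) {k m : ℕ} (hk : 3 * k ≤ m)
    (b a : ℕ) {G : ℕ → ℝ} {lo hi : ℝ} (hlo : ∀ j, lo ≤ G j) (hhi : ∀ j, G j ≤ hi) :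
    |pathMean p m b a (fun j => G (j + 1) - G j)| ≤
      (hi - lo) / 2 * (1 / (p * (1 - p) * √(k + 1))) := by
  obtain ⟨r, rfl⟩ := Nat.exists_eq_add_of_le hk
  have hq0 : 0 < p * (1 - p) := mul_pos hp0 (sub_pos.2 hp1)
  have hq1 : p * (1 - p) ≤ 1 := by nlinarith
  have h := abs_pathMean_binMean_diff_le hp0 hp1 k r b a 0 (G := fun j => G j - (lo + hi) / 2)
    (R := (hi - lo) / 2) (fun j => by rw [abs_le]; constructor <;> linarith [hlo j, hhi j])
  simp only [binMean, add_zero, sub_sub_sub_cancel_right] at h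
  refine h.trans ?_
  have e : (fun j : ℕ => (hi - lo) / 2 / √(((j : ℝ) + 1) * (p * (1 - p)))) =
      fun j : ℕ => (hi - lo) / 2 * (1 / √(((j : ℝ) + 1) * (p * (1 - p)))) := by
    funext j; ring
  rw [e, binMean_mul_left]
  exact mul_le_mul_of_nonneg_left (binMean_inv_sqrt_le hq0 hq1 k) (by linarith [hlo 0, hhi 0])

/-! ### Bernoulli means and their link with the random variables. -/

/-- The mean of `Φ (x₁, …, xₘ)` for independent Bernoulli variables `xᵢ` with success
probability `p`. -/
noncomputable def bernMean (p : ℝ) : (m : ℕ) → ((Fin m → ℕ) → ℝ) → ℝ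
  | 0, Φ => Φ ![]
  | m + 1, Φ => p * bernMean p m (fun x => Φ (Fin.cons 1 x)) +
      (1 - p) * bernMean p m (fun x => Φ (Fin.cons 0 x))

/-- The sum `b * x₁ + x₁ * x₂ + ⋯ + xₘ * a`. -/
def pathSum : (m : ℕ) → ℕ → (Fin m → ℕ) → ℕ → ℕ
  | 0, b, _, a => b * a
  | m + 1, b, x, a => b * x 0 + pathSum m (x 0) (Fin.tail x) a

theorem bernMean_pathSum (p : ℝ) (m b a : ℕ) (G : ℕ → ℝ) :
    bernMean p m (fun x => G (pathSum m b x a)) = pathMean p m b a G := by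
  induction m generalizing b G with
  | zero => rfl
  | succ m ih =>
    simp only [bernMean, pathSum, pathMean, Fin.cons_zero, Fin.tail_cons, mul_one, mul_zero,
      zero_add]
    rw [ih 1 (fun j => G (b + j)), ih 0 G]

theorem pathSum_eq_sum (m b a : ℕ) (x : Fin m → ℕ) :
    pathSum m b x a = ∑ i : Fin (m + 1), (Fin.cons b x : Fin (m + 1) → ℕ) i *
      (Fin.snoc x a : Fin (m + 1) → ℕ) i := by
  induction m generalizing b with
  | zero => simp [pathSum, Fin.snoc]
  | succ m ih =>
    conv_rhs => rw [Fin.sum_univ_succ]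
    rw [pathSum, ih]
    have e : (Fin.snoc x a : Fin (m + 1 + 1) → ℕ) 0 = x 0 := by
      rw [← Fin.castSucc_zero, Fin.snoc_castSucc]
    rw [e, Fin.cons_zero]
    congr 1
    refine Finset.sum_congr rfl fun i _ => ?_
    rw [Fin.cons_succ]
    congr 1
    · rw [← Fin.cons_self_tail x]; simp
    · conv_rhs => rw [← Fin.cons_self_tail x, ← Fin.cons_snoc_eq_snoc_cons, Fin.cons_succ]

theorem sum_mul_finRotate_cons (m b : ℕ) (x : Fin m → ℕ) :
    ∑ i : Fin (m + 1), (Fin.cons b x : Fin (m + 1) → ℕ) i *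
      (Fin.cons b x : Fin (m + 1) → ℕ) (finRotate (m + 1) i) = pathSum m b x b := by
  rw [pathSum_eq_sum]
  refine Finset.sum_congr rfl fun i _ => ?_
  congr 1
  induction i using Fin.lastCases with
  | last => simp
  | cast i =>
    rw [Fin.snoc_castSucc, finRotate_apply, Fin.coeSucc_eq_succ, Fin.cons_succ]

section

open MeasureTheory ProbabilityTheory

theorem integral_pi_bernoulliMeasure (p : unitInterval) (m : ℕ) (Φ : (Fin m → ℕ) → ℝ) :
    Integrable Φ (Measure.pi fun _ : Fin m => bernoulliMeasure 1 0 p) ∧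
      ∫ x, Φ x ∂(Measure.pi fun _ : Fin m => bernoulliMeasure 1 0 p) = bernMean p m Φ := by
  induction m with
  | zero =>
    rw [Measure.pi_of_empty _ ![]]
    exact ⟨integrable_dirac (by simp), by simp [bernMean]⟩
  | succ m ih =>
    have he := (measurePreserving_piFinSuccAbove
      (fun _ : Fin (m + 1) => bernoulliMeasure (1 : ℕ) 0 p) 0).symm
    have hemb := (MeasurableEquiv.piFinSuccAbove (fun _ : Fin (m + 1) => ℕ) 0).symm.measurableEmbedding
    rw [← he.integrable_comp_emb hemb, ← he.integral_comp hemb]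
    set π := Measure.pi fun _ : Fin m => bernoulliMeasure (1 : ℕ) 0 p
    have hprod : (bernoulliMeasure (1 : ℕ) 0 p).prod π =
        unitInterval.toNNReal p • Measure.map (Prod.mk 1) π +
          unitInterval.toNNReal (unitInterval.symm p) • Measure.map (Prod.mk 0) π := by
      rw [bernoulliMeasure_def, Measure.add_prod, Measure.prod_smul_left, Measure.prod_smul_left,
        Measure.dirac_prod, Measure.dirac_prod]
    set Ψ := Φ ∘ (MeasurableEquiv.piFinSuccAbove (fun _ : Fin (m + 1) => ℕ) 0).symm with hΨ
    have hΨc : ∀ c y, Ψ (c, y) = Φ (Fin.cons c y) := by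
      intro c y
      simp [hΨ, MeasurableEquiv.piFinSuccAbove_symm_apply, Fin.insertNthEquiv]
    have hi : ∀ c : ℕ, Integrable Ψ (Measure.map (Prod.mk c) π) ∧
        ∫ x, Ψ x ∂(Measure.map (Prod.mk c) π) = bernMean p m (fun x => Φ (Fin.cons c x)) := by
      intro c
      rw [integrable_map_measure .of_discrete .of_discrete,
        integral_map .of_discrete .of_discrete, Function.comp_def]
      simp only [hΨc]
      exact ih fun x => Φ (Fin.cons c x)
    change Integrable Ψ ((bernoulliMeasure (1 : ℕ) 0 p).prod π) ∧
      ∫ x, Ψ x ∂((bernoulliMeasure (1 : ℕ) 0 p).prod π) = _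
    rw [hprod]
    have i1 := (hi 1).1.smul_measure_nnreal (c := unitInterval.toNNReal p)
    have i0 := (hi 0).1.smul_measure_nnreal (c := unitInterval.toNNReal (unitInterval.symm p))
    refine ⟨i1.add_measure i0, ?_⟩
    rw [integral_add_measure i1 i0, integral_smul_nnreal_measure, integral_smul_nnreal_measure,
      (hi 1).2, (hi 0).2]
    simp [bernMean, NNReal.smul_def]

section

variable {Ω : Type*} [MeasurableSpace Ω] {P : Measure Ω} [IsProbabilityMeasure P] {n : ℕ}
  {p : unitInterval} {ξ : Fin n → Ω → ℕ}

theorem integral_comp_eq_bernMean (hlaw : ∀ i, HasLaw (ξ i) (bernoulliMeasure 1 0 p) P)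
    (hindep : iIndepFun ξ P) (Φ : (Fin n → ℕ) → ℝ) :
    Integrable (fun ω => Φ (fun i => ξ i ω)) P ∧
      ∫ ω, Φ (fun i => ξ i ω) ∂P = bernMean p n Φ := by
  have h := (iIndepFun_iff_map_fun_eq_pi_map fun i => (hlaw i).aemeasurable).1 hindep
  simp only [fun i => (hlaw i).map_eq] at h
  have hae : AEMeasurable (fun ω i => ξ i ω) P :=
    aemeasurable_pi_lambda _ fun i => (hlaw i).aemeasurable
  have := integral_pi_bernoulliMeasure p n Φ
  rw [← h, integrable_map_measure .of_discrete hae, integral_map hae .of_discrete] at this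
  exact this

end

/-- Every summand of `∑ i, x i * x (i + 1)` contributes the same to a mean. -/
theorem bernMean_sum_mul {p : unitInterval} (m : ℕ) (Ψ : ℕ → ℝ) (i : Fin (m + 1)) :
    bernMean p (m + 1) (fun x => ((x i * x (i + 1) : ℕ) : ℝ) * Ψ (∑ i, x i * x (i + 1))) =
      bernMean p (m + 1) (fun x => ((x 1 * x (1 + 1) : ℕ) : ℝ) * Ψ (∑ i, x i * x (i + 1))) := by
  have key : ∀ (σ : Equiv.Perm (Fin (m + 1))) (Φ : (Fin (m + 1) → ℕ) → ℝ),
      bernMean p (m + 1) (fun x => Φ (fun i => x (σ i))) = bernMean p (m + 1) Φ := by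
    intro σ Φ
    rw [← (integral_pi_bernoulliMeasure p _ _).2, ← (integral_pi_bernoulliMeasure p _ _).2]
    have h := measurePreserving_piCongrLeft
      (fun _ : Fin (m + 1) => bernoulliMeasure (1 : ℕ) 0 p) σ
    rw [← h.integral_comp (MeasurableEquiv.measurableEmbedding _)]
    refine integral_congr_ae (.of_forall fun x => ?_)
    simp only
    congr 1
    funext j
    exact Equiv.piCongrLeft_apply_apply (P := fun _ : Fin (m + 1) => ℕ) σ x j
  -- The rotation by `i - 1` moves index `1` to `i` and preserves the cyclic sum.
  have h := key (Equiv.addRight (i - 1))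
    (fun x => ((x 1 * x (1 + 1) : ℕ) : ℝ) * Ψ (∑ i, x i * x (i + 1)))
  rw [← h]
  congr 1
  funext x
  simp only [Equiv.coe_addRight]
  have e : ∑ j, x (j + (i - 1)) * x (j + 1 + (i - 1)) = ∑ j, x j * x (j + 1) := by
    rw [← Equiv.sum_comp (Equiv.addRight (i - 1)) (fun j => x j * x (j + 1))]
    simp only [Equiv.coe_addRight, add_right_comm]
  rw [e, add_sub_cancel, add_right_comm, add_sub_cancel]

theorem bernMean_add (p : ℝ) (m : ℕ) (Φ Ψ : (Fin m → ℕ) → ℝ) :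
    bernMean p m (fun x => Φ x + Ψ x) = bernMean p m Φ + bernMean p m Ψ := by
  induction m with
  | zero => rfl
  | succ m ih => simp only [bernMean, ih]; ring

theorem bernMean_mul_left (p c : ℝ) (m : ℕ) (Φ : (Fin m → ℕ) → ℝ) :
    bernMean p m (fun x => c * Φ x) = c * bernMean p m Φ := by
  induction m with
  | zero => rfl
  | succ m ih => simp only [bernMean, ih]; ring

theorem bernMean_sub (p : ℝ) (m : ℕ) (Φ Ψ : (Fin m → ℕ) → ℝ) :
    bernMean p m (fun x => Φ x - Ψ x) = bernMean p m Φ - bernMean p m Ψ := by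
  induction m with
  | zero => rfl
  | succ m ih => simp only [bernMean, ih]; ring

theorem bernMean_const (p c : ℝ) (m : ℕ) : bernMean p m (fun _ => c) = c := by
  induction m with
  | zero => rfl
  | succ m ih => simp only [bernMean, ih]; ring

theorem bernMean_finset_sum {ι : Type*} (p : ℝ) (m : ℕ) (s : Finset ι)
    (Φ : ι → (Fin m → ℕ) → ℝ) :
    bernMean p m (fun x => ∑ i ∈ s, Φ i x) = ∑ i ∈ s, bernMean p m (Φ i) := by
  classical
  induction s using Finset.induction_on with
  | empty => simpa using bernMean_const p 0 m
  | insert i s hi ih => simp only [Finset.sum_insert hi, bernMean_add, ih]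

/-! ### The Stein identity for cyclic 2-runs. -/

/-- The cyclic sum `∑ i, x i * x (i + 1)`. -/
def cyclicRuns {m : ℕ} (x : Fin (m + 1) → ℕ) : ℕ := ∑ i, x i * x (i + 1)

theorem cyclicRuns_cons {m : ℕ} (b : ℕ) (x : Fin m → ℕ) :
    cyclicRuns (Fin.cons b x : Fin (m + 1) → ℕ) = pathSum m b x b := by
  rw [← sum_mul_finRotate_cons]
  simp only [cyclicRuns, finRotate_apply]

/-- The mean of `G (s + V)`, where `V` is the number of 2-runs in a path of `m` Bernoulli variables
between the fixed values `β` and `α`. -/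
noncomputable def pathShift (p : ℝ) (m : ℕ) (G : ℕ → ℝ) (α β s : ℕ) : ℝ :=
  pathMean p m β α (fun j => G (s + j))

/-- Condition on four consecutive variables `α, u, v, β`. The others form a path from `β` to `α`,
and the weights are the law of `α u + u v + v β` given `α` and `β`. -/
theorem bernMean_comp_cyclicRuns (p : ℝ) (m : ℕ) (G : ℕ → ℝ) :
    bernMean p (m + 3 + 1) (fun x => G (cyclicRuns x)) =
      (1 - p) ^ 2 * ((1 - p ^ 2) * pathShift p m G 0 0 0 + p ^ 2 * pathShift p m G 0 0 1) +
      p * (1 - p) * ((1 - p) * pathShift p m G 1 0 0 + p * (1 - p) * pathShift p m G 1 0 1 +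
        p ^ 2 * pathShift p m G 1 0 2) +
      p * (1 - p) * ((1 - p) * pathShift p m G 0 1 0 + p * (1 - p) * pathShift p m G 0 1 1 +
        p ^ 2 * pathShift p m G 0 1 2) +
      p ^ 2 * ((1 - p) ^ 2 * pathShift p m G 1 1 0 + 2 * p * (1 - p) * pathShift p m G 1 1 1 +
        p ^ 2 * pathShift p m G 1 1 3) := by
  rw [bernMean]
  simp only [cyclicRuns_cons, bernMean_pathSum]
  simp only [pathShift, pathMean, zero_add, ← add_assoc, Nat.reduceAdd]
  ring

/-- In the same decomposition the factor forces `u = v = 1`, so the local count is `1 + α + β`. -/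
theorem bernMean_mul_comp_cyclicRuns (p : ℝ) (m : ℕ) (Ψ : ℕ → ℝ) :
    bernMean p (m + 3 + 1) (fun x => ((x 1 * x (1 + 1) : ℕ) : ℝ) * Ψ (cyclicRuns x)) =
      p ^ 2 * ((1 - p) ^ 2 * pathShift p m Ψ 0 0 1 + p * (1 - p) * pathShift p m Ψ 1 0 2 +
        p * (1 - p) * pathShift p m Ψ 0 1 2 + p ^ 2 * pathShift p m Ψ 1 1 3) := by
  have h : ∀ α u v : ℕ, bernMean p (m + 1) (fun x =>
      (((Fin.cons α (Fin.cons u (Fin.cons v x : Fin (m + 2) → ℕ) : Fin (m + 3) → ℕ) :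
        Fin (m + 3 + 1) → ℕ) 1 * (Fin.cons α (Fin.cons u (Fin.cons v x : Fin (m + 2) → ℕ) :
        Fin (m + 3) → ℕ) : Fin (m + 3 + 1) → ℕ) (1 + 1) : ℕ) : ℝ) *
        Ψ (cyclicRuns (Fin.cons α (Fin.cons u (Fin.cons v x : Fin (m + 2) → ℕ) :
        Fin (m + 3) → ℕ) : Fin (m + 3 + 1) → ℕ))) =
      ((u * v : ℕ) : ℝ) * pathMean p (m + 1) v α (fun j => Ψ (α * u + (u * v + j))) := by
    intro α u v
    rw [← bernMean_pathSum, ← bernMean_mul_left]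
    congr 1
    funext x
    rw [cyclicRuns_cons]
    rfl
  simp only [bernMean] at h ⊢
  simp only [h]
  simp only [pathShift, pathMean, zero_add, ← add_assoc, Nat.reduceAdd, mul_zero, zero_mul,
    mul_one, Nat.cast_zero, Nat.cast_one]
  ring

theorem bernMean_cyclicRuns_mul (p : unitInterval) (m : ℕ) (Ψ : ℕ → ℝ) :
    bernMean p (m + 3 + 1) (fun x => (cyclicRuns x : ℝ) * Ψ (cyclicRuns x)) =
      ((m : ℝ) + 4) * bernMean p (m + 3 + 1)
        (fun x => ((x 1 * x (1 + 1) : ℕ) : ℝ) * Ψ (cyclicRuns x)) := by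
  have e : ∀ x : Fin (m + 3 + 1) → ℕ, (cyclicRuns x : ℝ) * Ψ (cyclicRuns x) =
      ∑ i, ((x i * x (i + 1) : ℕ) : ℝ) * Ψ (cyclicRuns x) := by
    intro x; rw [← Finset.sum_mul, ← Nat.cast_sum]; rfl
  simp only [e]
  rw [bernMean_finset_sum]
  simp only [cyclicRuns]
  simp only [bernMean_sum_mul]
  simp
  left
  ring

theorem bernMean_cyclicRuns (p : unitInterval) (m : ℕ) :
    bernMean p (m + 3 + 1) (fun x => (cyclicRuns x : ℝ)) = ((m : ℝ) + 4) * (p : ℝ) ^ 2 := by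
  have h := bernMean_cyclicRuns_mul p m (fun _ => 1)
  rw [bernMean_mul_comp_cyclicRuns p m (fun _ => 1)] at h
  simp only [mul_one, pathShift, pathMean_const] at h
  rw [h]; ring

/-- The Stein operator of `Pn(n p² + b)` applied to the number of 2-runs plus `b`. -/
theorem bernMean_stein (p : unitInterval) (m b : ℕ) (f : ℕ → ℝ) (t : ℕ → ℕ → ℕ → ℝ)
    (ht : t = pathShift p m (fun j => f (j + b))) :
    bernMean p (m + 3 + 1) (fun x => (((m : ℝ) + 4) * (p : ℝ) ^ 2 + b) * f (cyclicRuns x + b) -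
        ((cyclicRuns x + b : ℕ) : ℝ) * f (cyclicRuns x + b - 1)) =
      ((m : ℝ) + 4) * (p : ℝ) ^ 2 *
        ((1 - (p : ℝ)) ^ 2 * ((p : ℝ) ^ 2 * (t 0 0 1 - t 0 0 0)) +
        p * (1 - (p : ℝ)) * ((1 - (p : ℝ)) * (t 1 0 0 - t 1 0 1) + (p : ℝ) ^ 2 * (t 1 0 2 - t 1 0 1)) +
        p * (1 - (p : ℝ)) * ((1 - (p : ℝ)) * (t 0 1 0 - t 0 1 1) + (p : ℝ) ^ 2 * (t 0 1 2 - t 0 1 1)) +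
        (p : ℝ) ^ 2 * ((1 - (p : ℝ)) ^ 2 * (t 1 1 0 - t 1 1 2) +
          2 * p * (1 - (p : ℝ)) * (t 1 1 1 - t 1 1 2) + (p : ℝ) ^ 2 * (t 1 1 3 - t 1 1 2))) +
      b * bernMean p (m + 3 + 1)
        (fun x => f (cyclicRuns x + b) - f (cyclicRuns x + b - 1)) := by
  have e : ∀ x : Fin (m + 3 + 1) → ℕ, (((m : ℝ) + 4) * (p : ℝ) ^ 2 + b) * f (cyclicRuns x + b) -
        ((cyclicRuns x + b : ℕ) : ℝ) * f (cyclicRuns x + b - 1) =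
      (((m : ℝ) + 4) * (p : ℝ) ^ 2 * f (cyclicRuns x + b) -
        (cyclicRuns x : ℝ) * f (cyclicRuns x + b - 1)) +
      b * (f (cyclicRuns x + b) - f (cyclicRuns x + b - 1)) := by
    intro x; push_cast; ring
  simp only [e]
  rw [bernMean_add, bernMean_mul_left, bernMean_sub, bernMean_mul_left]
  rw [bernMean_cyclicRuns_mul p m (fun j => f (j + b - 1)),
    bernMean_mul_comp_cyclicRuns p m (fun j => f (j + b - 1)),
    bernMean_comp_cyclicRuns p m (fun j => f (j + b))]
  -- The distinguished run makes the count at least `1`, so the subtraction is never truncated.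
  have hs : ∀ α β s, pathShift p m (fun j => f (j + b - 1)) α β (s + 1) = t α β s := by
    intro α β s
    rw [ht]
    unfold pathShift
    congr; funext j; lia
  rw [hs 0 0 0, hs 1 0 1, hs 0 1 1, hs 1 1 2, ht]
  ring

/-! ### First- and second-order bounds for the Stein combination. -/

/-- Once `t 1 1 0 - t 1 1 2` is split into two unit steps, the absolute weights sum to exactly `p *
(2 - p)`. -/
theorem abs_stein_first_order_le {p C : ℝ} (hp0 : 0 ≤ p) (hp1 : p ≤ 1) (t : ℕ → ℕ → ℕ → ℝ)
    (h : ∀ α β s, |t α β (s + 1) - t α β s| ≤ C) :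
    |(1 - p) ^ 2 * (p ^ 2 * (t 0 0 1 - t 0 0 0)) +
        p * (1 - p) * ((1 - p) * (t 1 0 0 - t 1 0 1) + p ^ 2 * (t 1 0 2 - t 1 0 1)) +
        p * (1 - p) * ((1 - p) * (t 0 1 0 - t 0 1 1) + p ^ 2 * (t 0 1 2 - t 0 1 1)) +
        p ^ 2 * ((1 - p) ^ 2 * (t 1 1 0 - t 1 1 2) +
          2 * p * (1 - p) * (t 1 1 1 - t 1 1 2) + p ^ 2 * (t 1 1 3 - t 1 1 2))| ≤
      C * (p * (2 - p)) := by
  have hq : 0 ≤ 1 - p := sub_nonneg.2 hp1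
  have key : ∀ w x : ℝ, 0 ≤ w → |x| ≤ C → w * x ≤ w * C ∧ -(w * C) ≤ w * x := fun w x hw hx =>
    ⟨mul_le_mul_of_nonneg_left (le_of_abs_le hx) hw,
      by have := mul_le_mul_of_nonneg_left (neg_le_of_abs_le hx) hw; linarith⟩
  have k1 := key ((1 - p) ^ 2 * p ^ 2) _ (by positivity) (h 0 0 0)
  have k2 := key (p * (1 - p) * (1 - p)) _ (by positivity) (h 1 0 0)
  have k3 := key (p * (1 - p) * p ^ 2) _ (by positivity) (h 1 0 1)
  have k4 := key (p * (1 - p) * (1 - p)) _ (by positivity) (h 0 1 0)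
  have k5 := key (p * (1 - p) * p ^ 2) _ (by positivity) (h 0 1 1)
  have k6 := key (p ^ 2 * (1 - p) ^ 2) _ (by positivity) (h 1 1 0)
  have k7 := key (p ^ 2 * (1 - p) ^ 2) _ (by positivity) (h 1 1 1)
  have k8 := key (p ^ 2 * (2 * p * (1 - p))) _ (by positivity) (h 1 1 1)
  have k9 := key (p ^ 2 * p ^ 2) _ (by positivity) (h 1 1 2)
  rw [abs_le]
  constructor <;> linarith

/-- The first-difference weights of the initial block sum to `-(2p - 3p²)`, while the bracket
multiplied by `2p - 3p²` is an average of first differences. The total weight is thus zero, and only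
second differences and changes of end values remain. -/
theorem abs_stein_second_order_le {p δ : ℝ} (hp0 : 0 ≤ p) (hp1 : p ≤ 2 / 3) (t : ℕ → ℕ → ℕ → ℝ)
    (h : ∀ α β s, |t α β (s + 2) - 2 * t α β (s + 1) + t α β s| ≤ δ)
    (hα : ∀ β, |(t 1 β 2 - t 1 β 1) - (t 0 β 2 - t 0 β 1)| ≤ p * δ)
    (hβ : ∀ α, |(t α 1 2 - t α 1 1) - (t α 0 2 - t α 0 1)| ≤ p * δ) :
    |(1 - p) ^ 2 * (p ^ 2 * (t 0 0 2 - t 0 0 1)) +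
        p * (1 - p) * ((1 - p) * (t 1 0 1 - t 1 0 2) + p ^ 2 * (t 1 0 3 - t 1 0 2)) +
        p * (1 - p) * ((1 - p) * (t 0 1 1 - t 0 1 2) + p ^ 2 * (t 0 1 3 - t 0 1 2)) +
        p ^ 2 * ((1 - p) ^ 2 * (t 1 1 1 - t 1 1 3) +
          2 * p * (1 - p) * (t 1 1 2 - t 1 1 3) + p ^ 2 * (t 1 1 4 - t 1 1 3)) +
      (2 * p - 3 * p ^ 2) *
        ((1 - p) ^ 2 * ((1 - p ^ 2) * (t 0 0 1 - t 0 0 0) + p ^ 2 * (t 0 0 2 - t 0 0 1)) +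
        p * (1 - p) * ((1 - p) * (t 1 0 1 - t 1 0 0) + p * (1 - p) * (t 1 0 2 - t 1 0 1) +
          p ^ 2 * (t 1 0 3 - t 1 0 2)) +
        p * (1 - p) * ((1 - p) * (t 0 1 1 - t 0 1 0) + p * (1 - p) * (t 0 1 2 - t 0 1 1) +
          p ^ 2 * (t 0 1 3 - t 0 1 2)) +
        p ^ 2 * ((1 - p) ^ 2 * (t 1 1 1 - t 1 1 0) + 2 * p * (1 - p) * (t 1 1 2 - t 1 1 1) +
          p ^ 2 * (t 1 1 4 - t 1 1 3)))| ≤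
      10 * p * (1 + 5 * p) * δ := by
  have hδ : 0 ≤ δ := (abs_nonneg _).trans (h 0 0 0)
  have hq : 0 ≤ 1 - p := by linarith
  have hq1 : 1 - p ≤ 1 := by linarith
  have he : 0 ≤ 2 - 3 * p := by linarith
  have hp' : p ≤ 1 := by linarith
  have hp2 : p ^ 2 ≤ 1 := pow_le_one₀ hp0 hp'
  have hp2' : 0 ≤ 1 - p ^ 2 := by linarith
  have hq2 : (1 - p) ^ 2 ≤ 1 := pow_le_one₀ hq hq1
  have hq3 : (1 - p) ^ 3 ≤ 1 := pow_le_one₀ hq hq1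
  have he1 : 1 + (2 * p - 3 * p ^ 2) ≤ 2 := by nlinarith [sq_nonneg (p - 1 / 3)]
  have he0 : 0 ≤ 2 * p - 3 * p ^ 2 := by nlinarith
  have key : ∀ w B k x : ℝ, 0 ≤ w → |B| ≤ k → |x| ≤ δ → |w * B * x| ≤ w * k * δ := by
    intro w B k x hw hB hx
    rw [abs_mul, abs_mul, abs_of_nonneg hw]
    have := mul_le_mul hB hx (abs_nonneg _) ((abs_nonneg _).trans hB)
    nlinarith [mul_le_mul_of_nonneg_left this hw]
  have keyp : ∀ B x : ℝ, |B| ≤ 1 → |x| ≤ p * δ → |p * B * x| ≤ p ^ 2 * δ := by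
    intro B x hB hx
    rw [abs_mul, abs_mul, abs_of_nonneg hp0]
    have := mul_le_mul hB hx (abs_nonneg _) zero_le_one
    nlinarith [mul_le_mul_of_nonneg_left this hp0]
  have hb0 : |-((2 - 3 * p) * (1 - p) ^ 2 * (1 - p ^ 2))| ≤ 2 := by
    rw [abs_neg, abs_of_nonneg (by positivity)]
    calc (2 - 3 * p) * (1 - p) ^ 2 * (1 - p ^ 2) ≤ 2 * 1 * 1 := by
          gcongr <;> linarith [sq_nonneg p]
      _ = 2 := by norm_num
  have hb1 : |p * (1 - p) * (1 + (2 * p - 3 * p ^ 2))| ≤ 2 := by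
    rw [abs_of_nonneg (by positivity)]
    calc p * (1 - p) * (1 + (2 * p - 3 * p ^ 2)) ≤ 1 * 1 * 2 := by gcongr
      _ = 2 := by norm_num
  have hb2 : |-((1 - p) ^ 2 * (2 - 3 * p))| ≤ 2 := by
    rw [abs_neg, abs_of_nonneg (by positivity)]
    calc (1 - p) ^ 2 * (2 - 3 * p) ≤ 1 * 2 := by gcongr; linarith
      _ = 2 := by norm_num
  have hb3 : |p ^ 2 * (1 + (2 * p - 3 * p ^ 2))| ≤ 2 := by
    rw [abs_of_nonneg (by positivity)]
    calc p ^ 2 * (1 + (2 * p - 3 * p ^ 2)) ≤ 1 * 2 := by gcongr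
      _ = 2 := by norm_num
  have hb4 : |-(1 - p ^ 2) + p ^ 2 * (1 + (2 * p - 3 * p ^ 2))| ≤ 2 := by
    have h1 := le_of_abs_le hb3
    have h2 : 0 ≤ p ^ 2 * (1 + (2 * p - 3 * p ^ 2)) := by positivity
    rw [abs_le]
    constructor <;> linarith [sq_nonneg p]
  have hb5 : |-((2 * p - 3 * p ^ 2) * (1 - p) ^ 2)| ≤ 1 := by
    rw [abs_neg, abs_of_nonneg (by positivity)]
    calc (2 * p - 3 * p ^ 2) * (1 - p) ^ 2 ≤ 1 * 1 := by gcongr; linarith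
      _ = 1 := by norm_num
  have hb6 : |-(1 - p) ^ 3| ≤ 1 := by rwa [abs_neg, abs_of_nonneg (by positivity)]
  have hb7 : |-(p * (1 - p) ^ 2)| ≤ 1 := by
    rw [abs_neg, abs_of_nonneg (by positivity)]
    calc p * (1 - p) ^ 2 ≤ 1 * 1 := by gcongr
      _ = 1 := by norm_num
  have hpp : 0 ≤ p ^ 2 := sq_nonneg p
  -- These twelve bounds add up to `(2p + 17p²) δ`, so crude coefficient bounds suffice.
  have k1 := abs_le.1 (key p _ _ _ hp0 hb0 (h 0 0 0))
  have k2 := abs_le.1 (key (p ^ 2) _ _ _ hpp hb1 (h 1 0 1))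
  have k3 := abs_le.1 (key (p ^ 2) _ _ _ hpp hb1 (h 0 1 1))
  have k4 := abs_le.1 (key (p ^ 2) _ _ _ hpp hb2 (h 1 0 0))
  have k5 := abs_le.1 (key (p ^ 2) _ _ _ hpp hb2 (h 0 1 0))
  have k6 := abs_le.1 (key (p ^ 2) _ _ _ hpp hb4 (h 1 1 1))
  have k7 := abs_le.1 (key (p ^ 2) _ _ _ hpp hb3 (h 1 1 2))
  have k8 := abs_le.1 (key (p ^ 2) _ _ _ hpp hb5 (h 1 1 0))
  have k9 := abs_le.1 (keyp _ _ hb6 (hα 0))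
  have k10 := abs_le.1 (keyp _ _ hb6 (hβ 0))
  have k11 := abs_le.1 (keyp _ _ hb7 (hα 1))
  have k12 := abs_le.1 (keyp _ _ hb7 (hβ 1))
  have hpd : 0 ≤ p * δ := by positivity
  have hppd : 0 ≤ p ^ 2 * δ := by positivity
  rw [abs_le]
  constructor <;> linarith

theorem abs_pathShift_diff_le {p : ℝ} (hp0 : 0 ≤ p) (hp1 : p ≤ 1) (m : ℕ) {G : ℕ → ℝ} {C : ℝ}
    (h : ∀ j, |G (j + 1) - G j| ≤ C) (α β s : ℕ) :
    |pathShift p m G α β (s + 1) - pathShift p m G α β s| ≤ C := by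
  unfold pathShift
  rw [← pathMean_sub]
  refine abs_pathMean_le hp0 hp1 _ _ _ fun j => ?_
  rw [add_right_comm]
  exact h _

theorem abs_pathShift_second_diff_le {p : ℝ} (hp0 : 0 < p) (hp1 : p < 1) {k m : ℕ}
    (hk : 3 * k ≤ m) {G : ℕ → ℝ} {lo hi : ℝ} (hlo : ∀ j, lo ≤ G (j + 1) - G j)
    (hhi : ∀ j, G (j + 1) - G j ≤ hi) (α β s : ℕ) :
    |pathShift p m G α β (s + 2) - 2 * pathShift p m G α β (s + 1) + pathShift p m G α β s| ≤
      (hi - lo) / 2 * (1 / (p * (1 - p) * √(k + 1))) := by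
  have h := abs_pathMean_diff_le hp0 hp1 hk β α (G := fun j => G (s + j + 1) - G (s + j))
    (fun j => hlo _) (fun j => hhi _)
  convert! h using 2
  simp only [pathMean_sub, pathShift]
  have e1 : ∀ j, s + 2 + j = s + (j + 1) + 1 := fun j => by lia
  have e2 : ∀ j, s + 1 + j = s + (j + 1) := fun j => by lia
  have e3 : ∀ j, s + j + 1 = s + (j + 1) := fun j => by lia
  simp only [e1, e2, e3]
  ring

theorem abs_pathShift_diff_endpoint_le {p : ℝ} (hp0 : 0 < p) (hp1 : p < 1) {k m : ℕ}
    (hk : 3 * k ≤ m) {G : ℕ → ℝ} {lo hi : ℝ} (hlo : ∀ j, lo ≤ G (j + 1) - G j)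
    (hhi : ∀ j, G (j + 1) - G j ≤ hi) (β s : ℕ) :
    |(pathShift p (m + 1) G 1 β (s + 1) - pathShift p (m + 1) G 1 β s) -
      (pathShift p (m + 1) G 0 β (s + 1) - pathShift p (m + 1) G 0 β s)| ≤
      p * ((hi - lo) / 2 * (1 / (p * (1 - p) * √(k + 1)))) := by
  have h := abs_pathMean_diff_le hp0 hp1 hk β 1 (G := fun j => G (s + j + 1) - G (s + j))
    (fun j => hlo _) (fun j => hhi _)
  have h1 := mul_le_mul_of_nonneg_left h hp0.le
  rw [← abs_of_pos hp0, ← abs_mul, abs_of_pos hp0] at h1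
  rw [← pathMean_one_sub_zero_right p m β (fun j => G (s + j + 1) - G (s + j))] at h1
  simp only [pathMean_sub] at h1
  simp only [pathShift, add_right_comm s 1]
  exact h1

theorem pathShift_comm (p : ℝ) (m : ℕ) (G : ℕ → ℝ) (α β s : ℕ) :
    pathShift p m G α β s = pathShift p m G β α s := pathMean_comm _ _ _ _ _

theorem abs_bernMean_le {p : ℝ} (hp0 : 0 ≤ p) (hp1 : p ≤ 1) (m : ℕ) {Φ : (Fin m → ℕ) → ℝ} {C : ℝ}
    (h : ∀ x, |Φ x| ≤ C) : |bernMean p m Φ| ≤ C := by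
  induction m with
  | zero => exact h _
  | succ m ih =>
    have h1 := abs_le.1 (ih (fun x => h (Fin.cons 1 x)))
    have h2 := abs_le.1 (ih (fun x => h (Fin.cons 0 x)))
    simp only [bernMean]
    rw [abs_le]
    constructor <;> nlinarith

theorem measureReal_comp_eq_bernMean {Ω : Type*} [MeasurableSpace Ω] {P : Measure Ω}
    [IsProbabilityMeasure P] {n : ℕ} {p : unitInterval} {ξ : Fin n → Ω → ℕ}
    (hlaw : ∀ i, HasLaw (ξ i) (bernoulliMeasure 1 0 p) P)
    (hindep : iIndepFun ξ P) (S : (Fin n → ℕ) → Prop) [DecidablePred S] :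
    P.real {ω | S (fun i => ξ i ω)} = bernMean p n (fun x => if S x then 1 else 0) := by
  have hae : AEMeasurable (fun ω i => ξ i ω) P :=
    aemeasurable_pi_lambda _ fun i => (hlaw i).aemeasurable
  rw [← (integral_comp_eq_bernMean hlaw hindep _).2,
    ← integral_map (f := fun x => if S x then (1 : ℝ) else 0) hae .of_discrete]
  have e : (fun x => if S x then (1 : ℝ) else 0) = {x | S x}.indicator 1 := by
    funext x; simp [Set.indicator_apply]
  rw [e, integral_indicator_one .of_discrete, measureReal_def, measureReal_def,
    Measure.map_apply_of_aemeasurable hae .of_discrete]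
  rfl

/-! ### Assembly of the two tail estimates. -/

section

variable {p : unitInterval} {m : ℕ} {lam : ℝ}

theorem bernMean_tail_sub_poissonUpper (b K : ℕ) (hlam : 0 < lam)
    (h : lam = ((m : ℝ) + 4) * (p : ℝ) ^ 2 + b) :
    bernMean p (m + 3 + 1) (fun x => if K + 1 ≤ cyclicRuns x + b then 1 else 0) -
        poissonUpper lam ((K + 1 : ℕ) : ℤ) =
      bernMean p (m + 3 + 1) (fun x => (((m : ℝ) + 4) * (p : ℝ) ^ 2 + b) *
        poissonStein lam K (cyclicRuns x + b) -
        ((cyclicRuns x + b : ℕ) : ℝ) * poissonStein lam K (cyclicRuns x + b - 1)) := by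
  simp only [← h, poissonStein_equation hlam]
  rw [bernMean_sub, bernMean_const]

theorem abs_tail_ratio_sub_one_le (hp0 : 0 < (p : ℝ)) (hlam : 0 < lam)
    (h : lam = ((m : ℝ) + 4) * (p : ℝ) ^ 2) (K : ℕ) :
    |bernMean p (m + 3 + 1) (fun x => if K + 1 ≤ cyclicRuns x then 1 else 0) /
        poissonUpper lam ((K + 1 : ℕ) : ℤ) - 1| ≤
      steinC1 lam ((K + 1 : ℕ) : ℤ) * (((m : ℝ) + 4) * (p : ℝ) ^ 3 * (2 - p)) := by
  obtain ⟨lo, hi, -, -, -, hC⟩ := exists_poissonStein_diff_bounds hlam K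
  have hQ := poissonUpper_pos hlam K
  have h1 := bernMean_tail_sub_poissonUpper (p := p) (m := m) 0 K hlam (by rw [h]; simp)
  rw [bernMean_stein p m 0 _ _ rfl] at h1
  simp only [add_zero, Nat.cast_zero, zero_mul] at h1
  rw [div_sub_one hQ.ne', abs_div, abs_of_pos hQ, div_le_iff₀ hQ, h1, abs_mul,
    abs_of_nonneg (by positivity)]
  have h2 := abs_stein_first_order_le p.2.1 p.2.2 (pathShift p m (poissonStein lam K))
    (abs_pathShift_diff_le p.2.1 p.2.2 m hC)
  refine (mul_le_mul_of_nonneg_left h2 (by positivity)).trans (le_of_eq ?_)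
  ring

/-- The constant works because `(9.2 / 5) ^ 2 = 3.3856` exceeds `3`, the loss from using one
variable in three; also `(1 - p) ^ 3 ≤ (1 - p) ^ 2`. -/
theorem five_div_le {x p s : ℝ} (hx : 0 < x) (hp0 : 0 ≤ p) (hp : p < 1) (hs : x ≤ 3 * s) :
    5 / ((1 - p) * √s) ≤ 9.2 / √(x * (1 - p) ^ 3) := by
  have hq : 0 < 1 - p := sub_pos.2 hp
  have hs0 : 0 < s := by linarith
  have hss : 0 < √s := Real.sqrt_pos.2 hs0
  rw [div_le_div_iff₀ (by positivity) (Real.sqrt_pos.2 (by positivity))]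
  have h1 : √(x * (1 - p) ^ 3) ≤ 1.84 * ((1 - p) * √s) := by
    rw [Real.sqrt_le_left (by positivity), mul_pow, mul_pow, Real.sq_sqrt hs0.le]
    have : x * (1 - p) ≤ x * 1 := by gcongr; linarith
    have : x * (1 - p) ≤ 3.3856 * s := by linarith
    have := mul_le_mul_of_nonneg_left this (sq_nonneg (1 - p))
    nlinarith
  linarith

theorem abs_shifted_tail_ratio_sub_one_le (hp0 : 0 < (p : ℝ)) (hp : (p : ℝ) < 2 / 3)
    (hm : 4 ≤ m) (hlam : 0 < lam) (c : ℕ)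
    (h : lam = ((m + 1 : ℕ) + 4) * (p : ℝ) ^ 2 + (c + 1 : ℕ))
    (hc0 : ((m + 1 : ℕ) + 4) * (p : ℝ) ^ 3 * (2 - 3 * p) ≤ (c + 1 : ℕ))
    (hc1 : ((c + 1 : ℕ) : ℝ) ≤ ((m + 1 : ℕ) + 4) * (p : ℝ) ^ 3 * (2 - 3 * p) + 1) (K : ℕ) :
    |bernMean p (m + 1 + 3 + 1) (fun x => if K + 1 ≤ cyclicRuns x + (c + 1) then 1 else 0) /
        poissonUpper lam ((K + 1 : ℕ) : ℤ) - 1| ≤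
      steinC2 lam ((K + 1 : ℕ) : ℤ) * (9.2 * ((m : ℝ) + 5) * (p : ℝ) ^ 2 * (1 + 5 * (p : ℝ)) /
        √(((m : ℝ) + 5 - 8) * (1 - (p : ℝ)) ^ 3)) +
      steinC1 lam ((K + 1 : ℕ) : ℤ) * min 1 lam := by
  obtain ⟨lo, hi, hlo, hhi, hC2, hC1⟩ := exists_poissonStein_diff_bounds hlam K
  have hQ := poissonUpper_pos hlam K
  have hp1 : (p : ℝ) < 1 := by linarith
  have h1 := bernMean_tail_sub_poissonUpper (p := p) (m := m + 1) (c + 1) K hlam h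
  rw [bernMean_stein p (m + 1) (c + 1) _ _ rfl] at h1
  set f := poissonStein lam K with hf
  set G : ℕ → ℝ := fun j => f (j + c + 1) - f (j + c) with hG
  set ψ : ℕ → ℝ := fun j => f (j + c) with hψ
  set t := pathShift p (m + 1) ψ with ht
  have hψ1 : ∀ j, ψ (j + 1) - ψ j = f (j + c + 1) - f (j + c) := fun j => by
    simp only [hψ, add_right_comm]
  have hts : ∀ α β s, pathShift p (m + 1) (fun j => f (j + (c + 1))) α β s = t α β (s + 1) := by
    intro α β s
    simp only [ht, pathShift, hψ]
    congr 1; funext j; congr 1; lia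
  have htG : ∀ α β s, pathShift p (m + 1) G α β s = t α β (s + 1) - t α β s := by
    intro α β s
    rw [← hts]
    simp only [ht, pathShift, hψ, hG, pathMean_sub, add_assoc]
  have hE : (fun x : Fin (m + 1 + 3 + 1) → ℕ =>
      f (cyclicRuns x + (c + 1)) - f (cyclicRuns x + (c + 1) - 1)) =
      fun x => G (cyclicRuns x) := rfl
  rw [hE] at h1
  have hEG : |bernMean p (m + 1 + 3 + 1) (fun x => G (cyclicRuns x))| ≤
      steinC1 lam ((K + 1 : ℕ) : ℤ) * poissonUpper lam ((K + 1 : ℕ) : ℤ) :=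
    abs_bernMean_le p.2.1 p.2.2 _ fun x => hC1 _
  have hEGe := bernMean_comp_cyclicRuns p (m + 1) G
  simp only [hts, htG, Nat.reduceAdd] at h1 hEGe
  set EG := bernMean p (m + 1 + 3 + 1) (fun x => G (cyclicRuns x))
  set k := m / 3
  have hk : 3 * k ≤ m := by lia
  have hlo' : ∀ j, lo ≤ ψ (j + 1) - ψ j := fun j => by rw [hψ1]; exact hlo _
  have hhi' : ∀ j, ψ (j + 1) - ψ j ≤ hi := fun j => by rw [hψ1]; exact hhi _
  have hα := fun β => abs_pathShift_diff_endpoint_le hp0 hp1 hk hlo' hhi' β 1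
  have h2 := abs_stein_second_order_le hp0.le hp.le t
    (abs_pathShift_second_diff_le hp0 hp1 (hk.trans (Nat.le_succ m)) hlo' hhi') hα
    (fun α => by
      have := hα α
      rw [pathShift_comm _ _ _ 1, pathShift_comm _ _ _ 1, pathShift_comm _ _ _ 0,
        pathShift_comm _ _ _ 0] at this
      exact this)
  rw [← hEGe] at h2
  generalize (1 - (p : ℝ)) ^ 2 * ((p : ℝ) ^ 2 * (t 0 0 2 - t 0 0 1)) +
        p * (1 - p) * ((1 - p) * (t 1 0 1 - t 1 0 2) + p ^ 2 * (t 1 0 3 - t 1 0 2)) +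
        p * (1 - p) * ((1 - p) * (t 0 1 1 - t 0 1 2) + p ^ 2 * (t 0 1 3 - t 0 1 2)) +
        p ^ 2 * ((1 - p) ^ 2 * (t 1 1 1 - t 1 1 3) +
          2 * p * (1 - p) * (t 1 1 2 - t 1 1 3) + p ^ 2 * (t 1 1 4 - t 1 1 3)) = X at h1 h2
  have hC10 : 0 ≤ steinC1 lam ((K + 1 : ℕ) : ℤ) * poissonUpper lam ((K + 1 : ℕ) : ℤ) :=
    (abs_nonneg _).trans hEG
  have hC20 : 0 ≤ hi - lo := by linarith [hlo 0, hhi 0]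
  -- The shift `c + 1` is `n p³ (2 - 3p)`, which cancels the first-order term, plus a rounding
  -- excess in `[0, 1]`.
  have hsplit : (((m + 1 : ℕ) : ℝ) + 4) * (p : ℝ) ^ 2 * X + ((c + 1 : ℕ) : ℝ) * EG =
      (((m + 1 : ℕ) : ℝ) + 4) * (p : ℝ) ^ 2 * (X + (2 * p - 3 * (p : ℝ) ^ 2) * EG) +
      (((c + 1 : ℕ) : ℝ) - ((m + 1 : ℕ) + 4) * (p : ℝ) ^ 3 * (2 - 3 * p)) * EG := by ring
  rw [div_sub_one hQ.ne', abs_div, abs_of_pos hQ, div_le_iff₀ hQ, h1, hsplit,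
    add_mul (_ * (_ / _))]
  refine (abs_add_le _ _).trans (add_le_add ?_ ?_)
  · rw [abs_mul, abs_of_nonneg (by positivity)]
    refine (mul_le_mul_of_nonneg_left h2 (by positivity)).trans ?_
    have hm3 : (m : ℝ) + 5 - 8 ≤ 3 * ((k : ℝ) + 1) := by
      have : m ≤ 3 * k + 2 := by lia
      have : (m : ℝ) ≤ 3 * k + 2 := by exact_mod_cast this
      linarith
    have hm0 : (0 : ℝ) < (m : ℝ) + 5 - 8 := by
      have : (4 : ℝ) ≤ m := by exact_mod_cast hm
      linarith
    have h5 := five_div_le hm0 hp0.le hp1 hm3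
    have hq : 0 < 1 - (p : ℝ) := sub_pos.2 hp1
    have hks : 0 < √((k : ℝ) + 1) := Real.sqrt_pos.2 (by positivity)
    calc _ = (hi - lo) * (((m : ℝ) + 5) * (p : ℝ) ^ 2 * (1 + 5 * (p : ℝ))) *
          (5 / ((1 - (p : ℝ)) * √((k : ℝ) + 1))) := by
          push_cast; field_simp; ring
      _ ≤ (hi - lo) * (((m : ℝ) + 5) * (p : ℝ) ^ 2 * (1 + 5 * (p : ℝ))) *
          (9.2 / √(((m : ℝ) + 5 - 8) * (1 - (p : ℝ)) ^ 3)) :=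
          mul_le_mul_of_nonneg_left h5 (by positivity)
      _ = _ := by rw [hC2]; ring
  · rw [abs_mul, abs_of_nonneg (by linarith)]
    have hl : ((c + 1 : ℕ) : ℝ) - ((m + 1 : ℕ) + 4) * (p : ℝ) ^ 3 * (2 - 3 * p) ≤ min 1 lam := by
      refine le_min (by linarith) ?_
      rw [h]
      have : 0 ≤ (((m + 1 : ℕ) : ℝ) + 4) * (p : ℝ) ^ 3 * (2 - 3 * p) :=
        mul_nonneg (by positivity) (by linarith)
      have : 0 ≤ (((m + 1 : ℕ) : ℝ) + 4) * (p : ℝ) ^ 2 := by positivity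
      linarith
    refine (mul_le_mul hl hEG (abs_nonneg _) (le_min zero_le_one hlam.le)).trans (le_of_eq ?_)
    ring

end

end

theorem mainTheorem12 {Ω : Type*} [MeasurableSpace Ω] (P : MeasureTheory.Measure Ω)
    [MeasureTheory.IsProbabilityMeasure P]
    (n : ℕ) (hn : 9 ≤ n) (p : unitInterval) (hp0 : 0 < (p : ℝ)) (hp : (p : ℝ) < 2 / 3)
    (ξ : Fin n → Ω → ℕ)
    (hlaw : ∀ i, ProbabilityTheory.HasLaw (ξ i) (ProbabilityTheory.bernoulliMeasure 1 0 p) P)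
    (hindep : ProbabilityTheory.iIndepFun ξ P)
    (μ : ℝ) (hμ : μ = ∫ ω, (twoRuns ξ ω : ℝ) ∂P)
    (a : ℤ) (ha : a = ⌊(n : ℝ) * (p : ℝ) ^ 3 * (3 * (p : ℝ) - 2)⌋)
    (lam : ℝ) (hlam : lam = μ - (a : ℝ)) :
    (∀ k : ℤ, μ < (k : ℝ) →
      |P.real {ω | k ≤ (twoRuns ξ ω : ℤ)} / poissonUpper μ k - 1|
        ≤ steinC1 μ k * ((n : ℝ) * (p : ℝ) ^ 3 * (2 - (p : ℝ)))) ∧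
    (∀ k : ℤ, lam < (k : ℝ) →
      |P.real {ω | k ≤ (twoRuns ξ ω : ℤ) - a} / poissonUpper lam k - 1|
        ≤ steinC2 lam k * (9.2 * (n : ℝ) * (p : ℝ) ^ 2 * (1 + 5 * (p : ℝ)) /
              Real.sqrt (((n : ℝ) - 8) * (1 - (p : ℝ)) ^ 3))
          + steinC1 lam k * min 1 lam) := by

  -- Four variables are conditioned on, leaving a path of `m + 1`; comparing end values uses up one
  -- more.
  obtain ⟨m, rfl⟩ : ∃ m, n = m + 1 + 3 + 1 := ⟨n - 5, by lia⟩
  have hm : 4 ≤ m := by lia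
  have hW : ∀ ω, twoRuns ξ ω = cyclicRuns (fun i => ξ i ω) := fun ω => by
    simp only [twoRuns, cyclicRuns, finRotate_apply]
  have hn' : ((m + 1 + 3 + 1 : ℕ) : ℝ) = ((m + 1 : ℕ) : ℝ) + 4 := by push_cast; ring
  have hμ' : μ = (((m + 1 : ℕ) : ℝ) + 4) * (p : ℝ) ^ 2 := by
    rw [hμ, ← bernMean_cyclicRuns, ← (integral_comp_eq_bernMean hlaw hindep _).2]
    simp only [hW]
  have hμ0 : 0 < μ := by rw [hμ']; positivity
  have hkK : ∀ k : ℤ, 0 < (k : ℝ) → ∃ K : ℕ, k = ((K + 1 : ℕ) : ℤ) := fun k hk => by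
    have : 0 < k := by exact_mod_cast hk
    exact ⟨(k - 1).toNat, by lia⟩
  constructor
  · intro k hk
    obtain ⟨K, rfl⟩ := hkK k (hμ0.trans hk)
    have hP := measureReal_comp_eq_bernMean hlaw hindep (fun x => K + 1 ≤ cyclicRuns x)
    have e : {ω | ((K + 1 : ℕ) : ℤ) ≤ (twoRuns ξ ω : ℤ)} =
        {ω | K + 1 ≤ cyclicRuns (fun i => ξ i ω)} := by
      ext ω; simp only [Set.mem_ofPred_eq, hW, Nat.cast_le]
    rw [e, hP, hn']
    exact abs_tail_ratio_sub_one_le hp0 hμ0 hμ' K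
  · intro k hk
    rw [hn'] at ha
    set y := (((m + 1 : ℕ) : ℝ) + 4) * (p : ℝ) ^ 3 * (2 - 3 * p) with hy
    have hy0 : 0 < y := mul_pos (by positivity) (by linarith)
    have hya : (((m + 1 : ℕ) : ℝ) + 4) * (p : ℝ) ^ 3 * (3 * p - 2) = -y := by rw [hy]; ring
    rw [hya] at ha
    have ha0 : (a : ℝ) ≤ -y := ha ▸ Int.floor_le _
    have ha1 : -y < a + 1 := ha ▸ Int.lt_floor_add_one _
    have haneg : a < 0 := by
      have : (a : ℝ) < 0 := by linarith
      exact_mod_cast this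
    -- As `p < 2 / 3` makes `a` negative, `W - a` is a natural number shifted upwards by at least
    -- one.
    obtain ⟨c, hc⟩ : ∃ c : ℕ, a = -((c + 1 : ℕ) : ℤ) := ⟨(-a - 1).toNat, by lia⟩
    have hac : (a : ℝ) = -((c + 1 : ℕ) : ℝ) := by rw [hc]; push_cast; ring
    have hlam' : lam = (((m + 1 : ℕ) : ℝ) + 4) * (p : ℝ) ^ 2 + ((c + 1 : ℕ) : ℝ) := by
      rw [hlam, hμ', hac]; ring
    have hlam0 : 0 < lam := by rw [hlam']; positivity
    obtain ⟨K, rfl⟩ := hkK k (hlam0.trans hk)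
    have hP := measureReal_comp_eq_bernMean hlaw hindep
      (fun x => K + 1 ≤ cyclicRuns x + (c + 1))
    have e : {ω | ((K + 1 : ℕ) : ℤ) ≤ (twoRuns ξ ω : ℤ) - a} =
        {ω | K + 1 ≤ cyclicRuns (fun i => ξ i ω) + (c + 1)} := by
      ext ω
      simp only [Set.mem_ofPred_eq, hW, hc]
      lia
    have hn5 : ((m + 1 + 3 + 1 : ℕ) : ℝ) = (m : ℝ) + 5 := by push_cast; ring
    rw [e, hP, hn5]
    exact abs_shifted_tail_ratio_sub_one_le hp0 hp hm hlam0 c hlam' (by linarith) (by linarith) K
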